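/- Let $r\ge 1$, let $\zeta$ be a primitive $r$-th root of unity, let $c_0\in\mathbb{C}$, and let $d_0,\dots,d_{r-1}\in\mathbb{C}$ with $d_0+\dots+d_{r-1}=0$, indices being read modulo $r$. Let $W=G(r,1,2)$ be the group of $2\times 2$ monomial matrices whose nonzero entries are $r$-th roots of unity, acting on $\mathfrak h=\mathbb{C}^2$ with standard basis $y_1,y_2$ and on $\mathfrak h^*$ with dual basis $x_1,x_2$. Let $\zeta_p\in W$ be the diagonal matrix with $\zeta$ in position $p$ and $1$ in the other position, and let $s\in W$ be the permutation matrix of the transposition. The rational Cherednik algebra $\mathbb{H}$ is the $\mathbb{C}$-algebra generated by $\mathbb{C}[x_1,x_2]$, $\mathbb{C}[y_1,y_2]$ and $\overline{w}$ ($w\in W$) with the relations $\overline{1}=1$, $\overline{w}\,\overline{v}=\overline{wv}$, $\overline{w}x=(wx)\overline{w}$, $\overline{w}y=(wy)\overline{w}$ for $w,v\in W$, $x\in\mathfrak h^*$, $y\in\mathfrak h$, and $$y_px_q=x_qy_p+c_0\sum_{l=0}^{r-1}\zeta^{-l}\,\overline{\zeta_p^l s\zeta_p^{-l}}\quad(p\ne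 q),$$ $$y_px_p=x_py_p+1-\sum_{l=0}^{r-1}(d_l-d_{l-1})e_{p,l}-c_0\sum_{l=0}^{r-1}\overline{\zeta_p^l s\zeta_p^{-l}},\qquad e_{p,l}=\frac1r\sum_{t=0}^{r-1}\zeta^{-tl}\,\overline{\zeta_p^t}.$$ For $0\le a\ne b\le r-1$ let $S^{\lambda_{a,b}}$ be the irreducible $W$-module with basis $v_{T_1},v_{T_2}$ on which $\zeta_1v_{T_1}=\zeta^{a}v_{T_1}$, $\zeta_2v_{T_1}=\zeta^{b}v_{T_1}$, $\zeta_1v_{T_2}=\zeta^{b}v_{T_2}$, $\zeta_2v_{T_2}=\zeta^{a}v_{T_2}$, and $s$ exchanges $v_{T_1}$ and $v_{T_2}$. Let $\Delta(\lambda_{a,b})$ be the standard module, that is, the $\mathbb{H}$-module induced from the $\mathbb{C}W\otimes\mathbb{C}[y_1,y_2]$-module $S^{\lambda_{a,b}}$ on which $y_1,y_2$ act by $0$. Theorem. Let $i,j,k\in\{0,\dots,r-1\}$ with $i\ne k$ and $i\ne j$. Suppose that $c_0$ is a nonzero integer, that $d_i-d_k+c_0r$ and $d_i-d_k-c_0r$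 are nonnegative integers congruent to $i-k$ modulo $r$, and that $d_j-d_i+c_0r$ and $d_j-d_i-c_0r$ are nonnegative integers congruent to $j-i$ modulo $r$. Then $$\dim_{\mathbb{C}}\mathrm{Hom}_{\mathbb{H}}(\Delta(\lambda_{i,k}),\Delta(\lambda_{i,j}))=2.$$ -/

import Mathlib

open scoped TensorProduct

noncomputable section

namespace RCA

/-- A `2 × 2` complex matrix with exactly one nonzero entry in each row and column, each such entry
being an `r`-th root of unity. -/
def IsMonomial (r : ℕ) (A : Matrix (Fin 2) (Fin 2) ℂ) : Prop :=
  ∃ σ : Equiv.Perm (Fin 2), ∀ p q, (p = σ q → A p q ^ r = 1) ∧ (p ≠ σ q → A p q = 0)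

theorem isMonomial_iff {r : ℕ} {A : Matrix (Fin 2) (Fin 2) ℂ} :
    IsMonomial r A ↔
      (A 0 0 ^ r = 1 ∧ A 1 1 ^ r = 1 ∧ A 0 1 = 0 ∧ A 1 0 = 0) ∨
      (A 0 1 ^ r = 1 ∧ A 1 0 ^ r = 1 ∧ A 0 0 = 0 ∧ A 1 1 = 0) := by
  constructor
  · rintro ⟨σ, h⟩
    have hσ : σ = 1 ∨ σ = Equiv.swap 0 1 := by
      have : ∀ τ : Equiv.Perm (Fin 2), τ = 1 ∨ τ = Equiv.swap 0 1 := by decide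
      exact this σ
    rcases hσ with rfl | rfl
    · left
      exact ⟨(h 0 0).1 rfl, (h 1 1).1 rfl, (h 0 1).2 (by decide), (h 1 0).2 (by decide)⟩
    · right
      exact ⟨(h 0 1).1 (by decide), (h 1 0).1 (by decide), (h 0 0).2 (by decide),
        (h 1 1).2 (by decide)⟩
  · rintro (⟨h1, h2, h3, h4⟩ | ⟨h1, h2, h3, h4⟩)
    · refine ⟨1, fun p q => ?_⟩
      fin_cases p <;> fin_cases q <;> simp [h1, h2, h3, h4]
    · refine ⟨Equiv.swap 0 1, fun p q => ?_⟩
      fin_cases p <;> fin_cases q <;> simp [h1, h2, h3, h4]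

/-- The complex reflection group `G(r,1,2)`. -/
def W (r : ℕ) [NeZero r] : Subgroup (GL (Fin 2) ℂ) where
  carrier := {g | IsMonomial r (g : Matrix (Fin 2) (Fin 2) ℂ)}
  one_mem' := by
    simp [isMonomial_iff]
  mul_mem' := by
    intro a b ha hb
    simp only [Set.mem_ofPred_eq, isMonomial_iff] at ha hb ⊢
    rcases ha with ⟨h1, h2, h3, h4⟩ | ⟨h1, h2, h3, h4⟩ <;>
    rcases hb with ⟨k1, k2, k3, k4⟩ | ⟨k1, k2, k3, k4⟩ <;>
    simp [Matrix.mul_apply, Fin.sum_univ_two, mul_pow, *]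
  inv_mem' := by
    intro g hg
    simp only [Set.mem_ofPred_eq, isMonomial_iff] at hg ⊢
    have key : ∀ z : ℂ, z ^ r = 1 → z ≠ 0 := by
      rintro z hz rfl
      simp [NeZero.ne r] at hz
    have hdet : (g : Matrix (Fin 2) (Fin 2) ℂ).det ≠ 0 := by
      rw [Matrix.det_fin_two]
      rcases hg with ⟨h1, h2, h3, h4⟩ | ⟨h1, h2, h3, h4⟩ <;>
      simp [h3, h4, key _ h1, key _ h2]
    rw [Matrix.coe_units_inv, Matrix.inv_def, Matrix.adjugate_fin_two, Matrix.det_fin_two]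
    rcases hg with ⟨h1, h2, h3, h4⟩ | ⟨h1, h2, h3, h4⟩ <;>
    [left; right] <;>
    simp [h1, h2, h3, h4, mul_pow, inv_pow]

/-- The matrix of a group element. -/
def mat {r : ℕ} [NeZero r] (w : W r) : Matrix (Fin 2) (Fin 2) ℂ :=
  ((w : GL (Fin 2) ℂ) : Matrix (Fin 2) (Fin 2) ℂ)

/-- `ζ_p`: the diagonal matrix with `ζ` in position `p` and `1` elsewhere. -/
def zetaElt {r : ℕ} [NeZero r] (ζ : rootsOfUnity r ℂ) (p : Fin 2) : W r :=
  ⟨Units.map (Matrix.diagonalRingHom (Fin 2) ℂ).toMonoidHom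
      (MulEquiv.piUnits.symm (Pi.mulSingle p (ζ : ℂˣ))), by
    have h : ((ζ : ℂˣ) : ℂ) ^ r = 1 := by
      have := ζ.2
      rw [mem_rootsOfUnity'] at this
      exact this
    change IsMonomial r _
    rw [isMonomial_iff]
    left
    fin_cases p <;> simp [h, Pi.mulSingle, Function.update]⟩

/-- The permutation matrix exchanging the two coordinates. -/
def swapElt (r : ℕ) [NeZero r] : W r :=
  ⟨⟨!![0, 1; 1, 0], !![0, 1; 1, 0], by simp [Matrix.one_fin_two], by simp [Matrix.one_fin_two]⟩, by
    change IsMonomial r _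
    rw [isMonomial_iff]
    right
    simp⟩

theorem mat_zetaElt {r : ℕ} [NeZero r] (ζ : rootsOfUnity r ℂ) (p : Fin 2) :
    mat (zetaElt ζ p) = Matrix.diagonal (fun q => if q = p then ((ζ : ℂˣ) : ℂ) else 1) := by
  ext a b
  fin_cases p <;> fin_cases a <;> fin_cases b <;>
    simp [mat, zetaElt, Pi.mulSingle, Function.update]

theorem mat_swapElt (r : ℕ) [NeZero r] : mat (swapElt r) = !![0, 1; 1, 0] := rfl

theorem mat_mul {r : ℕ} [NeZero r] (u w : W r) : mat (u * w) = mat u * mat w := rfl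

theorem mat_one {r : ℕ} [NeZero r] : mat (1 : W r) = 1 := rfl

theorem mat_cases {r : ℕ} [NeZero r] (w : W r) :
    (mat w 0 0 ≠ 0 ∧ mat w 1 1 ≠ 0 ∧ mat w 0 1 = 0 ∧ mat w 1 0 = 0) ∨
      (mat w 0 1 ≠ 0 ∧ mat w 1 0 ≠ 0 ∧ mat w 0 0 = 0 ∧ mat w 1 1 = 0) := by
  have key : ∀ z : ℂ, z ^ r = 1 → z ≠ 0 := by
    rintro z hz rfl
    simp [NeZero.ne r] at hz
  rcases isMonomial_iff.1 w.2 with ⟨h1, h2, h3, h4⟩ | ⟨h1, h2, h3, h4⟩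
  · exact Or.inl ⟨key _ h1, key _ h2, h3, h4⟩
  · exact Or.inr ⟨key _ h1, key _ h2, h3, h4⟩

/-- Generators `x₁, x₂` (basis of `𝔥*`), `y₁, y₂` (basis of `𝔥`) and `w̄` for `w ∈ W`. -/
inductive Gen (r : ℕ) [NeZero r] : Type
  | x (p : Fin 2)
  | y (p : Fin 2)
  | g (w : W r)

section Algebra

variable {r : ℕ} [NeZero r]

/-- The free algebra on the generators. -/
abbrev Free (r : ℕ) [NeZero r] : Type := FreeAlgebra ℂ (Gen r)

/-- The free generator `x_p`. -/
def fx (p : Fin 2) : Free r := FreeAlgebra.ι ℂ (Gen.x p)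

/-- The free generator `y_p`. -/
def fy (p : Fin 2) : Free r := FreeAlgebra.ι ℂ (Gen.y p)

/-- The free generator `w̄`. -/
def fg (w : W r) : Free r := FreeAlgebra.ι ℂ (Gen.g w)

/-- The idempotent `e_{p,l} = (1/r) ∑_{t=0}^{r-1} ζ^{-tl} ζ_p^t`. -/
def idem (ζ : rootsOfUnity r ℂ) (p : Fin 2) (l : ZMod r) : Free r :=
  (1 / (r : ℂ)) • ∑ t ∈ Finset.range r,
    (((ζ : ℂˣ) : ℂ)⁻¹ ^ (t * l.val)) • fg (zetaElt ζ p ^ t)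

/-- The reflection `ζ_p^l s ζ_p^{-l}`, with `s` the transposition. -/
def refl (ζ : rootsOfUnity r ℂ) (p : Fin 2) (l : ℕ) : W r :=
  zetaElt ζ p ^ l * swapElt r * (zetaElt ζ p ^ l)⁻¹

/-- The defining relations. The group acts on `𝔥 = ℂ²` by `w y_p = ∑ q, w_{qp} y_q`, and on `𝔥*` by
the dual action `w x_p = ∑ q, (w⁻¹)_{pq} x_q`. -/
inductive Rel (ζ : rootsOfUnity r ℂ) (c₀ : ℂ) (d : ZMod r → ℂ) : Free r → Free r → Prop
  | x_comm (p q : Fin 2) : Rel ζ c₀ d (fx p * fx q) (fx q * fx p)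
  | y_comm (p q : Fin 2) : Rel ζ c₀ d (fy p * fy q) (fy q * fy p)
  | g_one : Rel ζ c₀ d (fg 1) 1
  | g_mul (u w : W r) : Rel ζ c₀ d (fg u * fg w) (fg (u * w))
  | g_x (w : W r) (p : Fin 2) :
      Rel ζ c₀ d (fg w * fx p) ((∑ q, mat w⁻¹ p q • fx q) * fg w)
  | g_y (w : W r) (p : Fin 2) :
      Rel ζ c₀ d (fg w * fy p) ((∑ q, mat w q p • fy q) * fg w)
  | y_x_ne (p q : Fin 2) (h : p ≠ q) :
      Rel ζ c₀ d (fy p * fx q)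
        (fx q * fy p +
          c₀ • ∑ l ∈ Finset.range r, (((ζ : ℂˣ) : ℂ)⁻¹ ^ l) • fg (refl ζ p l))
  | y_x_self (p : Fin 2) :
      Rel ζ c₀ d (fy p * fx p)
        (fx p * fy p + 1 - ∑ l : ZMod r, (d l - d (l - 1)) • idem ζ p l
          - c₀ • ∑ l ∈ Finset.range r, fg (refl ζ p l))

/-- The rational Cherednik algebra of `G(r,1,2)` with parameters `c₀` and `d`. -/
def H (ζ : rootsOfUnity r ℂ) (c₀ : ℂ) (d : ZMod r → ℂ) : Type := RingQuot (Rel ζ c₀ d)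

instance (ζ : rootsOfUnity r ℂ) (c₀ : ℂ) (d : ZMod r → ℂ) : Ring (H ζ c₀ d) :=
  inferInstanceAs (Ring (RingQuot (Rel ζ c₀ d)))

instance (ζ : rootsOfUnity r ℂ) (c₀ : ℂ) (d : ZMod r → ℂ) : Algebra ℂ (H ζ c₀ d) :=
  inferInstanceAs (Algebra ℂ (RingQuot (Rel ζ c₀ d)))

variable (ζ : rootsOfUnity r ℂ) (c₀ : ℂ) (d : ZMod r → ℂ)

/-- The element `y_p` of the rational Cherednik algebra. -/
def Hy (p : Fin 2) : H ζ c₀ d := RingQuot.mkAlgHom ℂ (Rel ζ c₀ d) (fy p)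

/-- The element `w̄` of the rational Cherednik algebra. -/
def Hg (w : W r) : H ζ c₀ d := RingQuot.mkAlgHom ℂ (Rel ζ c₀ d) (fg w)

/-- The `H`-submodule of `H ⊗_ℂ V` generated by `w̄ ⊗ v - 1 ⊗ w v` and `y_p ⊗ v`. -/
def indRel {V : Type} [AddCommGroup V] [Module ℂ V] (ρ : Representation ℂ (W r) V) :
    Submodule (H ζ c₀ d) (H ζ c₀ d ⊗[ℂ] V) :=
  Submodule.span (H ζ c₀ d)
    ({m | ∃ (w : W r) (v : V), m = Hg ζ c₀ d w ⊗ₜ[ℂ] v - (1 : H ζ c₀ d) ⊗ₜ[ℂ] ρ w v} ∪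
      {m | ∃ (p : Fin 2) (v : V), m = Hy ζ c₀ d p ⊗ₜ[ℂ] v})

/-- The standard module of a representation `V` of `W`: the `H`-module induced from `V`, on which
`y₁` and `y₂` act by zero. -/
abbrev Standard {V : Type} [AddCommGroup V] [Module ℂ V] (ρ : Representation ℂ (W r) V) : Type :=
  (H ζ c₀ d ⊗[ℂ] V) ⧸ indRel ζ c₀ d ρ

end Algebra

section Rep

variable {r : ℕ} [NeZero r]

/-- The matrix by which `w` acts on the representation of type `λ_{i,j}` in the basis
`v_{T₁}, v_{T₂}`: `diag(a,b)` acts by `a^i b^j` on `v_{T₁}` and by `a^j b^i` on `v_{T₂}`, and the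
coordinate exchange exchanges `v_{T₁}` and `v_{T₂}`. -/
def pairMat (i j : ZMod r) (w : W r) : Matrix (Fin 2) (Fin 2) ℂ :=
  Matrix.of fun p q =>
    if mat w p q = 0 then 0 else mat w p q ^ i.val * mat w p.rev q.rev ^ j.val

/-- The representation `S^{λ_{i,j}}` of `G(r,1,2)`. -/
def pairRep (i j : ZMod r) : Representation ℂ (W r) (Fin 2 → ℂ) :=
  (Matrix.toLinAlgEquiv' : Matrix (Fin 2) (Fin 2) ℂ ≃ₐ[ℂ] _).toMonoidHom.comp
    { toFun := pairMat i j
      map_one' := by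
        ext p q
        fin_cases p <;> fin_cases q <;> simp [pairMat, mat_one]
      map_mul' := by
        intro u w
        ext p q
        rcases mat_cases u with ⟨h1, h2, h3, h4⟩ | ⟨h1, h2, h3, h4⟩ <;>
        rcases mat_cases w with ⟨k1, k2, k3, k4⟩ | ⟨k1, k2, k3, k4⟩ <;>
        fin_cases p <;> fin_cases q <;>
        simp [pairMat, mat_mul, Matrix.mul_apply, Fin.sum_univ_two, mul_pow, Fin.rev,
          h1, h2, h3, h4, k1, k2, k3, k4] <;> ring }

theorem pairRep_apply (i j : ZMod r) (w : W r) (v : Fin 2 → ℂ) :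
    pairRep i j w v = (pairMat i j w).mulVec v := rfl

/-- `ζ₁ v_{T₁} = ζ^i v_{T₁}`, `ζ₁ v_{T₂} = ζ^j v_{T₂}`. -/
theorem pairRep_zeta_one (ζ : rootsOfUnity r ℂ) (i j : ZMod r) :
    pairRep i j (zetaElt ζ 0) ![1, 0] = ((ζ : ℂˣ) : ℂ) ^ i.val • ![1, 0] ∧
      pairRep i j (zetaElt ζ 0) ![0, 1] = ((ζ : ℂˣ) : ℂ) ^ j.val • ![0, 1] := by
  constructor <;> ext p <;> fin_cases p <;>
    simp [pairRep_apply, pairMat, mat_zetaElt, Matrix.mulVec, dotProduct, Fin.rev]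

/-- `ζ₂ v_{T₁} = ζ^j v_{T₁}`, `ζ₂ v_{T₂} = ζ^i v_{T₂}`. -/
theorem pairRep_zeta_two (ζ : rootsOfUnity r ℂ) (i j : ZMod r) :
    pairRep i j (zetaElt ζ 1) ![1, 0] = ((ζ : ℂˣ) : ℂ) ^ j.val • ![1, 0] ∧
      pairRep i j (zetaElt ζ 1) ![0, 1] = ((ζ : ℂˣ) : ℂ) ^ i.val • ![0, 1] := by
  constructor <;> ext p <;> fin_cases p <;>
    simp [pairRep_apply, pairMat, mat_zetaElt, Matrix.mulVec, dotProduct, Fin.rev]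

/-- The coordinate exchange exchanges `v_{T₁}` and `v_{T₂}`. -/
theorem pairRep_swap (i j : ZMod r) :
    pairRep i j (swapElt r) ![1, 0] = ![0, 1] ∧ pairRep i j (swapElt r) ![0, 1] = ![1, 0] := by
  constructor <;> ext p <;> fin_cases p <;>
    simp [pairRep_apply, pairMat, mat_swapElt, Matrix.mulVec, dotProduct, Fin.rev]

/-- The standard module `Δ(λ_{i,j})`. -/
abbrev StandardPair (ζ : rootsOfUnity r ℂ) (c₀ : ℂ) (d : ZMod r → ℂ) (i j : ZMod r) : Type :=
  Standard ζ c₀ d (pairRep i j)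

end Rep

end RCA

end

set_option linter.unusedSectionVars false

noncomputable section

namespace RCA

/-! ### The polynomial space with the actions of the variables and of the group. -/

section Model

variable {r : ℕ} [NeZero r]

/-! The standard module of `λ_{i,j}` is `ℂ[x₁,x₂] ⊗ S` with `y₁, y₂` acting by Dunkl operators. A
homomorphism from the standard module of `λ_{i,k}` is therefore the same thing as a polynomial of
weight `(i,k)` under the diagonal generators that both Dunkl operators kill (`range_evalHom`,
`finrank_hom`).

Put `D = d_i - d_k` and `E = d_j - d_i`. By hypothesis these are natural numbers, congruent to `i -
k` and `j - i` modulo `r` and at least `|c₀| r` (`exists_nat_gap`). On coefficients, the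
`y₁`-equation at `x₁^a x₂^b ⊗ v_T` says that `a - gap` times the coefficient equals `c₀ r` times an
alternating partial sum of `a` terms over the other index, where `gap` is `0` on `v_{T₁}` and `E` on
`v_{T₂}`.

Upper bound (`eq_zero_of_singular`): induction on `min a b` shows that a singular polynomial is
determined by its coefficients at `x₂^{D+E} ⊗ v_{T₁}` and `x₁^E x₂^D ⊗ v_{T₂}`, the only places
where the diagonal factors allow a new free value.

Lower bound (`finrank_singular`): in degree `D + E` the `y₂`-equations repeat the `y₁`-equations,
because the partial sums are antisymmetric under reversal. The equation at `x₂^{D+E} ⊗ v_{T₁}` is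
void. The equation at `x₁^E x₂^D ⊗ v_{T₂}` has diagonal factor zero and demands that one partial sum
vanish. If it follows from the others, there are two equations fewer than unknowns.

That it does follow is the heart of the matter (`revSum_eq_zero`). Sorted by residues modulo `r`,
the partial sums satisfy two coupled first order recurrences, solved by a terminating balanced `₄F₃`
series (`eq_zero_of_recurrence`). Its last value is the product of `1 - c₀²/m²` over `1 ≤ m ≤
min(⌊D/r⌋, ⌊E/r⌋)`, which vanishes because `c₀` is a nonzero integer with `|c₀|` in this range. -/

theorem pow_val_add {u : ℂ} (hu : u ^ r = 1) (m n : ZMod r) :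
    u ^ (m + n).val = u ^ m.val * u ^ n.val := by
  rw [ZMod.val_add, ← pow_add, ← pow_mod_orderOf u (m.val + n.val), ← pow_mod_orderOf,
    Nat.mod_mod_of_dvd _ (orderOf_dvd_of_pow_eq_one hu)]

theorem pow_val_natCast {u : ℂ} (hu : u ^ r = 1) (n : ℕ) : u ^ (n : ZMod r).val = u ^ n := by
  rw [ZMod.val_natCast, ← pow_mod_orderOf, Nat.mod_mod_of_dvd _ (orderOf_dvd_of_pow_eq_one hu),
    pow_mod_orderOf]

theorem pow_val_one {u : ℂ} (hu : u ^ r = 1) : u ^ (1 : ZMod r).val = u := by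
  simpa using pow_val_natCast hu 1

theorem ne_zero_of_pow {u : ℂ} (hu : u ^ r = 1) : u ≠ 0 := by
  rintro rfl
  simp [NeZero.ne r] at hu

theorem pow_val_add_one {u : ℂ} (hu : u ^ r = 1) (m : ZMod r) :
    u ^ (m + 1).val = u * u ^ m.val := by
  rw [pow_val_add hu, pow_val_one hu, mul_comm]

theorem pow_val_sub_one {u : ℂ} (hu : u ^ r = 1) (m : ZMod r) :
    u ^ (m - 1).val = u⁻¹ * u ^ m.val := by
  have h := pow_val_add_one hu (m - 1)
  rw [sub_add_cancel] at h
  rw [h, inv_mul_cancel_left₀ (ne_zero_of_pow hu)]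

theorem pow_val_sub {u : ℂ} (hu : u ^ r = 1) (m n : ZMod r) :
    u ^ (m - n).val = u ^ m.val * (u ^ n.val)⁻¹ := by
  have h := pow_val_add hu (m - n) n
  rw [sub_add_cancel] at h
  rw [h, mul_inv_cancel_right₀ (pow_ne_zero _ (ne_zero_of_pow hu))]

theorem pow_val_inj {u : ℂ} (hu : IsPrimitiveRoot u r) {m n : ZMod r}
    (h : u ^ m.val = u ^ n.val) : m = n :=
  ZMod.val_injective r (hu.pow_inj (ZMod.val_lt m) (ZMod.val_lt n) h)

theorem sum_range_pow_val {u : ℂ} (hu : IsPrimitiveRoot u r) (m : ZMod r) :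
    ∑ l ∈ Finset.range r, (u ^ m.val) ^ l = if m = 0 then (r : ℂ) else 0 := by
  split_ifs with h
  · simp [h]
  · have h1 : u ^ m.val ≠ 1 := fun h' => h (pow_val_inj hu (by simpa using h'))
    rw [geom_sum_eq h1, ← pow_mul, mul_comm, pow_mul, hu.pow_eq_one]
    simp

/-- Exponents `a, b` and an index `T`, labelling the vector `x₁^a x₂^b ⊗ v_T`. -/
abbrev Mon : Type := ℕ × ℕ × Fin 2

/-- The space with basis `x₁^a x₂^b ⊗ v_T`. -/
def Poly : Type := Mon →₀ ℂ

instance : AddCommGroup Poly := inferInstanceAs (AddCommGroup (Mon →₀ ℂ))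

instance : Module ℂ Poly := inferInstanceAs (Module ℂ (Mon →₀ ℂ))

/-- The basis of the vectors `x₁^a x₂^b ⊗ v_T`. -/
def monBasis : Module.Basis Mon ℂ Poly :=
  Module.Basis.ofRepr (LinearEquiv.refl ℂ (Mon →₀ ℂ) : Poly ≃ₗ[ℂ] (Mon →₀ ℂ))

/-- The basis vector `x₁^a x₂^b ⊗ v_T`. -/
def monom (α : Mon) : Poly := monBasis α

/-- The linear operator with prescribed values on the basis vectors. -/
def opOf (φ : Mon → Poly) : Module.End ℂ Poly := monBasis.constr ℂ φ

@[simp] theorem opOf_monom (φ : Mon → Poly) (α : Mon) : opOf φ (monom α) = φ α :=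
  monBasis.constr_basis ℂ φ α

theorem end_ext {M : Type*} [AddCommMonoid M] [Module ℂ M] {A B : Poly →ₗ[ℂ] M}
    (h : ∀ a b T, A (monom (a, b, T)) = B (monom (a, b, T))) : A = B :=
  monBasis.ext fun α => h α.1 α.2.1 α.2.2

/-- Exchange of the two variables together with the two basis vectors. -/
def flip (α : Mon) : Mon := (α.2.1, α.1, α.2.2.rev)

@[simp] theorem flip_mk (a b : ℕ) (T : Fin 2) : flip (a, b, T) = (b, a, T.rev) := rfl

theorem flip_flip (α : Mon) : flip (flip α) = α := by
  simp [flip]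

/-- The weight of `x₁^a x₂^b ⊗ v_T` under the first or second diagonal generator, when `v_T` has
weights `lab T` and `lab T.rev`. -/
def wt (lab : Fin 2 → ZMod r) (p : Fin 2) (α : Mon) : ZMod r :=
  if p = 0 then lab α.2.2 - α.1 else lab α.2.2.rev - α.2.1

theorem wt_zero (lab : Fin 2 → ZMod r) (a b : ℕ) (T : Fin 2) :
    wt lab 0 (a, b, T) = lab T - a := rfl

theorem wt_one (lab : Fin 2 → ZMod r) (a b : ℕ) (T : Fin 2) :
    wt lab 1 (a, b, T) = lab T.rev - b := rfl

theorem wt_flip (lab : Fin 2 → ZMod r) (p : Fin 2) (α : Mon) :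
    wt lab p (flip α) = wt lab p.rev α := by
  fin_cases p <;> simp [wt, flip]

/-- Raising an exponent. -/
def raise (p : Fin 2) (α : Mon) : Mon :=
  if p = 0 then (α.1 + 1, α.2.1, α.2.2) else (α.1, α.2.1 + 1, α.2.2)

theorem raise_zero (a b : ℕ) (T : Fin 2) : raise 0 (a, b, T) = (a + 1, b, T) := rfl

theorem raise_one (a b : ℕ) (T : Fin 2) : raise 1 (a, b, T) = (a, b + 1, T) := rfl

/-- Multiplication by a variable. -/
def opX (p : Fin 2) : Module.End ℂ Poly := opOf fun α => monom (raise p α)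

theorem opX_monom (p : Fin 2) (α : Mon) : opX p (monom α) = monom (raise p α) := opOf_monom _ _

theorem opX_comm (p q : Fin 2) : opX p * opX q = opX q * opX p := by
  refine end_ext fun a b T => ?_
  fin_cases p <;> fin_cases q <;> simp [Module.End.mul_apply, opX_monom, raise]

variable (lab : Fin 2 → ZMod r)

/-- The action of a group element. -/
def opG (w : W r) : Module.End ℂ Poly := opOf fun α =>
  if mat w 0 0 ≠ 0 then
    (mat w 0 0 ^ (wt lab 0 α).val * mat w 1 1 ^ (wt lab 1 α).val) • monom α
  else (mat w 0 1 ^ (wt lab 1 α).val * mat w 1 0 ^ (wt lab 0 α).val) • monom (flip α)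

theorem opG_diag {w : W r} (h : mat w 0 0 ≠ 0) (α : Mon) :
    opG lab w (monom α) =
      (mat w 0 0 ^ (wt lab 0 α).val * mat w 1 1 ^ (wt lab 1 α).val) • monom α := by
  rw [opG, opOf_monom, if_pos h]

theorem opG_anti {w : W r} (h : mat w 0 0 = 0) (α : Mon) :
    opG lab w (monom α) =
      (mat w 0 1 ^ (wt lab 1 α).val * mat w 1 0 ^ (wt lab 0 α).val) • monom (flip α) := by
  rw [opG, opOf_monom, if_neg (not_not.2 h)]

theorem mat_pow_cases (w : W r) :
    (mat w 0 0 ^ r = 1 ∧ mat w 1 1 ^ r = 1 ∧ mat w 0 1 = 0 ∧ mat w 1 0 = 0) ∨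
      (mat w 0 1 ^ r = 1 ∧ mat w 1 0 ^ r = 1 ∧ mat w 0 0 = 0 ∧ mat w 1 1 = 0) :=
  isMonomial_iff.1 w.2

theorem opG_one : opG lab (1 : W r) = 1 := by
  refine end_ext fun a b T => ?_
  rw [opG_diag] <;> simp [mat_one]

theorem opG_mul (u w : W r) : opG lab u * opG lab w = opG lab (u * w) := by
  refine end_ext fun a b T => ?_
  rw [Module.End.mul_apply]
  rcases mat_pow_cases u with ⟨h1, h2, h3, h4⟩ | ⟨h1, h2, h3, h4⟩ <;>
  rcases mat_pow_cases w with ⟨k1, k2, k3, k4⟩ | ⟨k1, k2, k3, k4⟩ <;>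
  have h1' := ne_zero_of_pow h1 <;> have h2' := ne_zero_of_pow h2 <;>
  have k1' := ne_zero_of_pow k1 <;> have k2' := ne_zero_of_pow k2
  · rw [opG_diag lab k1', map_smul, opG_diag lab h1', opG_diag lab (by simp [mat_mul,
      Matrix.mul_apply, *]), smul_smul]
    congr 1
    simp [mat_mul, Matrix.mul_apply, h3, h4, mul_pow]
    ring
  · rw [opG_anti lab k3, map_smul, opG_diag lab h1', opG_anti lab (by simp [mat_mul,
      Matrix.mul_apply, *]), smul_smul, wt_flip, wt_flip]
    congr 1
    simp [mat_mul, Matrix.mul_apply, h3, h4, mul_pow]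
    ring
  · rw [opG_diag lab k1', map_smul, opG_anti lab h3, opG_anti lab (by simp [mat_mul,
      Matrix.mul_apply, *]), smul_smul]
    congr 1
    simp [mat_mul, Matrix.mul_apply, h3, h4, mul_pow]
    ring
  · rw [opG_anti lab k3, map_smul, opG_anti lab h3, opG_diag lab (by simp [mat_mul,
      Matrix.mul_apply, *]), smul_smul, wt_flip, wt_flip, flip_flip]
    congr 1
    simp [mat_mul, Matrix.mul_apply, h3, h4, mul_pow]
    ring

theorem mat_inv_diag {w : W r} (h : mat w 0 0 ≠ 0) (p q : Fin 2) :
    mat w⁻¹ p q = (mat w q p)⁻¹ := by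
  have e : mat w⁻¹ * mat w = 1 := by rw [← mat_mul, inv_mul_cancel, mat_one]
  have e' : ∀ p q, (mat w⁻¹ * mat w) p q = (1 : Matrix (Fin 2) (Fin 2) ℂ) p q := by simp [e]
  rcases mat_cases w with ⟨k1, k2, k3, k4⟩ | ⟨k1, k2, k3, k4⟩
  · have a1 := e' 0 0
    have a2 := e' 0 1
    have a3 := e' 1 0
    have a4 := e' 1 1
    simp only [Matrix.mul_apply, Fin.sum_univ_two, k3, k4, mul_zero, add_zero, zero_add,
      Matrix.one_apply_eq, ne_eq, Matrix.one_apply_ne, zero_ne_one, one_ne_zero,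
      not_false_eq_true, mul_eq_zero, k1, k2, or_false] at a1 a2 a3 a4
    fin_cases p <;> fin_cases q <;> simp [k3, k4, a2, a3, eq_inv_of_mul_eq_one_left a1,
      eq_inv_of_mul_eq_one_left a4]
  · exact absurd k3 h

theorem mat_inv_anti {w : W r} (h : mat w 0 0 = 0) (p q : Fin 2) :
    mat w⁻¹ p q = (mat w q p)⁻¹ := by
  have e : mat w⁻¹ * mat w = 1 := by rw [← mat_mul, inv_mul_cancel, mat_one]
  have e' : ∀ p q, (mat w⁻¹ * mat w) p q = (1 : Matrix (Fin 2) (Fin 2) ℂ) p q := by simp [e]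
  rcases mat_cases w with ⟨k1, k2, k3, k4⟩ | ⟨k1, k2, k3, k4⟩
  · exact absurd h k1
  · have a1 := e' 0 0
    have a2 := e' 0 1
    have a3 := e' 1 0
    have a4 := e' 1 1
    simp only [Matrix.mul_apply, Fin.sum_univ_two, k3, k4, mul_zero, add_zero, zero_add,
      Matrix.one_apply_eq, ne_eq, Matrix.one_apply_ne, zero_ne_one, one_ne_zero,
      not_false_eq_true, mul_eq_zero, k1, k2, or_false] at a1 a2 a3 a4
    fin_cases p <;> fin_cases q <;> simp [k3, k4, a2, a3, eq_inv_of_mul_eq_one_left a1,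
      eq_inv_of_mul_eq_one_left a4]

/-- The inverse of a monomial matrix is its transpose with inverted entries; the convention `0⁻¹ =
0` takes care of the zero entries. -/
theorem mat_inv (w : W r) (p q : Fin 2) : mat w⁻¹ p q = (mat w q p)⁻¹ := by
  by_cases h : mat w 0 0 = 0
  · exact mat_inv_anti h p q
  · exact mat_inv_diag h p q

theorem opG_opX (w : W r) (p : Fin 2) :
    opG lab w * opX p = (∑ q, mat w⁻¹ p q • opX q) * opG lab w := by
  refine end_ext fun a b T => ?_
  rw [Module.End.mul_apply, Module.End.mul_apply, opX_monom]
  rcases mat_pow_cases w with ⟨k1, k2, k3, k4⟩ | ⟨k1, k2, k3, k4⟩ <;>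
  have k1' := ne_zero_of_pow k1 <;> have k2' := ne_zero_of_pow k2
  · rw [opG_diag lab k1', opG_diag lab k1']
    fin_cases p <;>
    simp [mat_inv, k3, k4, opX_monom, smul_smul, raise_zero, raise_one, wt_zero, wt_one,
      ← sub_sub, pow_val_sub_one k1, pow_val_sub_one k2] <;>
    ring_nf
  · rw [opG_anti lab k3, opG_anti lab k3]
    fin_cases p <;>
    simp [mat_inv, k3, k4, opX_monom, smul_smul, raise_zero, raise_one, wt_zero, wt_one,
      ← sub_sub, pow_val_sub_one k1, pow_val_sub_one k2] <;>
    ring_nf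

end Model

/-! ### Dunkl operators, their commutators with the variables, and their commutativity. -/

section Dunkl

variable {r : ℕ} [NeZero r] (lab : Fin 2 → ZMod r) (c₀ : ℂ) (d : ZMod r → ℂ)

/-- The operator exchanging the two coordinates. -/
def opS : Module.End ℂ Poly := opOf fun α => monom (flip α)

@[simp] theorem opS_monom (α : Mon) : opS (monom α) = monom (flip α) := opOf_monom _ _

theorem opS_mul_self : opS * opS = 1 :=
  end_ext fun a b T => by simp [Module.End.mul_apply]

/-- The operator acting by a scalar on each weight space. -/
def opD (φ : ZMod r → ZMod r → ℂ) : Module.End ℂ Poly :=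
  opOf fun α => φ (wt lab 0 α) (wt lab 1 α) • monom α

@[simp] theorem opD_monom (φ : ZMod r → ZMod r → ℂ) (α : Mon) :
    opD lab φ (monom α) = φ (wt lab 0 α) (wt lab 1 α) • monom α := opOf_monom _ _

theorem opD_mul_opS (φ : ZMod r → ZMod r → ℂ) :
    opD lab φ * opS = opS * opD lab fun m n => φ n m :=
  end_ext fun a b T => by simp [Module.End.mul_apply, wt_zero, wt_one]

theorem opD_smul (c : ℂ) (φ : ZMod r → ZMod r → ℂ) :
    (opD lab fun m n => c * φ m n) = c • opD lab φ :=
  end_ext fun a b T => by simp [smul_smul]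

theorem opG_eq_opD {w : W r} (h : mat w 0 0 ≠ 0) :
    opG lab w = opD lab fun m n => mat w 0 0 ^ m.val * mat w 1 1 ^ n.val :=
  end_ext fun a b T => by rw [opG_diag lab h, opD_monom]

theorem opG_eq_opS {w : W r} (h : mat w 0 0 = 0) :
    opG lab w = opS * opD lab fun m n => mat w 0 1 ^ n.val * mat w 1 0 ^ m.val :=
  end_ext fun a b T => by
    rw [opG_anti lab h, Module.End.mul_apply, opD_monom, map_smul, opS_monom]

/-- The partial sum entering the divided difference part of the Dunkl operator. -/
def tail (α : Mon) (n : ℕ) : Poly :=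
  ∑ m ∈ Finset.range n, if lab α.2.2.rev - m - 1 = wt lab 0 α then
    monom (m, α.1 + α.2.1 - 1 - m, α.2.2.rev) else 0

/-- The Dunkl operator in the first direction. -/
def opY₀ : Module.End ℂ Poly := opOf fun α =>
  ((α.1 : ℂ) - (d (lab α.2.2) - d (wt lab 0 α))) • monom (α.1 - 1, α.2.1, α.2.2) -
    (c₀ * r) • (tail lab α α.1 - tail lab α α.2.1)

/-- The Dunkl operators. -/
def opY (p : Fin 2) : Module.End ℂ Poly :=
  if p = 0 then opY₀ lab c₀ d else opS * opY₀ lab c₀ d * opS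

theorem opY_zero : opY lab c₀ d 0 = opY₀ lab c₀ d := rfl

theorem opY_one : opY lab c₀ d 1 = opS * opY₀ lab c₀ d * opS := rfl

/-- Summing the divided differences over the `r` reflections keeps one residue class of exponents
and produces the factor `r`; the difference of the two tails is this quotient, with the right sign
whether `a` or `b` is larger. For `a = 0` the scalar before the first term is `0`, so the truncated
exponent `a - 1` does no harm. -/
theorem opY₀_monom (a b : ℕ) (T : Fin 2) : opY₀ lab c₀ d (monom (a, b, T)) =
    ((a : ℂ) - (d (lab T) - d (lab T - a))) • monom (a - 1, b, T) -
      (c₀ * r) • (tail lab (a, b, T) a - tail lab (a, b, T) b) := opOf_monom _ _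

theorem opS_mul_opY (p : Fin 2) : opS * opY lab c₀ d p = opY lab c₀ d p.rev * opS := by
  have h : p = 0 ∨ p = 1 := by fin_cases p <;> simp
  rcases h with rfl | rfl
  · change _ = opY lab c₀ d 1 * opS
    rw [opY_zero, opY_one, mul_assoc, opS_mul_self, mul_one]
  · change _ = opY lab c₀ d 0 * opS
    rw [opY_zero, opY_one, mul_assoc, ← mul_assoc, opS_mul_self, one_mul]

theorem opS_mul_opX (p : Fin 2) : opS * opX p = opX p.rev * opS := by
  refine end_ext fun a b T => ?_
  fin_cases p <;> simp [Module.End.mul_apply, opX_monom, raise_zero, raise_one]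

/-- All monomials of a tail have the same weight: the original one with its first component raised
by one. -/
theorem opD_tail (φ : ZMod r → ZMod r → ℂ) (a b : ℕ) (T : Fin 2) (n : ℕ) (hn : n ≤ a + b) :
    opD lab φ (tail lab (a, b, T) n) =
      φ (lab T - a + 1) (lab T.rev - b) • tail lab (a, b, T) n := by
  rw [tail, map_sum, Finset.smul_sum]
  refine Finset.sum_congr rfl fun m hm => ?_
  have hm' := Finset.mem_range.1 hm
  split_ifs with h
  · simp only [wt_zero] at h
    rw [opD_monom, wt_zero, wt_one]
    have h1 : ((a + b - 1 - m : ℕ) : ZMod r) = a + b - 1 - m := by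
      rw [Nat.cast_sub (by omega), Nat.cast_sub (by omega)]
      push_cast
      ring
    have e1 : lab T.rev - m = lab T - a + 1 := by linear_combination h
    have e2 : lab T.rev.rev - ((a + b - 1 - m : ℕ) : ZMod r) = lab T.rev - b := by
      rw [h1, Fin.rev_rev]
      linear_combination -h
    simp only [e1, e2]
  · simp

theorem opD_mul_opY₀ (φ : ZMod r → ZMod r → ℂ) :
    opD lab φ * opY₀ lab c₀ d = opY₀ lab c₀ d * opD lab fun m n => φ (m + 1) n := by
  refine end_ext fun a b T => ?_
  rw [Module.End.mul_apply, Module.End.mul_apply, opD_monom, map_smul, opY₀_monom, wt_zero, wt_one,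
    map_sub, map_smul, map_smul, map_sub, opD_tail _ _ _ _ _ _ (by omega),
    opD_tail _ _ _ _ _ _ (by omega)]
  have h : ((a : ℂ) - (d (lab T) - d (lab T - a))) • opD lab φ (monom (a - 1, b, T)) =
      φ (lab T - a + 1) (lab T.rev - b) •
        ((a : ℂ) - (d (lab T) - d (lab T - a))) • monom (a - 1, b, T) := by
    rcases a with _ | a
    · simp
    · rw [opD_monom, wt_zero, wt_one, smul_comm]
      congr 2
      push_cast
      ring_nf
  rw [h]
  module

theorem opD_mul_opY_one (φ : ZMod r → ZMod r → ℂ) :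
    opD lab φ * opY lab c₀ d 1 = opY lab c₀ d 1 * opD lab fun m n => φ m (n + 1) := by
  rw [opY_one, ← mul_assoc, ← mul_assoc, opD_mul_opS, mul_assoc opS, opD_mul_opY₀, mul_assoc,
    mul_assoc, opD_mul_opS]
  simp only [mul_assoc]

theorem opG_opY (w : W r) (p : Fin 2) :
    opG lab w * opY lab c₀ d p = (∑ q, mat w q p • opY lab c₀ d q) * opG lab w := by
  have h : p = 0 ∨ p = 1 := by fin_cases p <;> simp
  rcases mat_pow_cases w with ⟨k1, k2, k3, k4⟩ | ⟨k1, k2, k3, k4⟩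
  · rw [opG_eq_opD lab (ne_zero_of_pow k1)]
    rcases h with rfl | rfl
    · rw [opY_zero, opD_mul_opY₀]
      simp [k4, pow_val_add_one k1, mul_assoc, opD_smul, opY_zero]
    · rw [opD_mul_opY_one]
      simp [k3, pow_val_add_one k2, mul_left_comm, opD_smul]
  · rw [opG_eq_opS lab k3]
    rcases h with rfl | rfl
    · rw [mul_assoc, opY_zero, opD_mul_opY₀, ← mul_assoc, ← opY_zero, opS_mul_opY]
      simp [k3, pow_val_add_one k2, mul_left_comm, opD_smul, mul_assoc]
    · rw [mul_assoc, opD_mul_opY_one, ← mul_assoc, opS_mul_opY]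
      simp [k4, pow_val_add_one k1, mul_assoc, opD_smul]

/-- The commutator of a Dunkl operator with the variable in the same direction. -/
def comSelf (p : Fin 2) : Module.End ℂ Poly := opOf fun α =>
  (1 - (d (wt lab p α) - d (wt lab p α - 1))) • monom α -
    if wt lab 0 α = wt lab 1 α then (c₀ * r) • monom (flip α) else 0

/-- The commutator of a Dunkl operator with the variable in the other direction. -/
def comNe (p : Fin 2) : Module.End ℂ Poly := opOf fun α =>
  if wt lab p.rev α - wt lab p α = 1 then (c₀ * r) • monom (flip α) else 0

/-- Multiplication by `x₁` shifts the summation index of the tails by one. The lost term at index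
`0` cancels in the difference of tails, and the cut at `b` instead of `b + 1` leaves a single
flipped monomial, the reflection part of the commutator. -/
theorem opY₀_opX_zero :
    opY₀ lab c₀ d * opX 0 = opX 0 * opY₀ lab c₀ d + comSelf lab c₀ d 0 := by
  refine end_ext fun a b T => ?_
  have ht : ∀ n, opX 0 (tail lab (a, b, T) n) =
      tail lab (a + 1, b, T) (n + 1) - tail lab (a + 1, b, T) 1 := by
    intro n
    rw [tail, tail, tail, Finset.sum_range_succ', Finset.sum_range_one, add_sub_cancel_right,
      map_sum]
    refine Finset.sum_congr rfl fun m _ => ?_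
    have : lab T.rev - m - 1 = lab T - a ↔
        lab T.rev - ((m + 1 : ℕ) : ZMod r) - 1 = lab T - ((a + 1 : ℕ) : ZMod r) := by
      push_cast
      constructor <;> intro h <;> linear_combination h
    rw [wt_zero, wt_zero, apply_ite (opX 0), opX_monom, raise_zero, map_zero]
    refine ite_congr (propext this) (fun _ => ?_) fun _ => rfl
    change monom (m + 1, a + b - 1 - m, T.rev) = monom (m + 1, a + 1 + b - 1 - (m + 1), T.rev)
    congr 3
    omega
  have hb : tail lab (a + 1, b, T) (b + 1) = tail lab (a + 1, b, T) b +
      if lab T - a = lab T.rev - b then monom (b, a, T.rev) else 0 := by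
    rw [tail, Finset.sum_range_succ]
    congr 1
    have : lab T.rev - b - 1 = lab T - ((a + 1 : ℕ) : ZMod r) ↔ lab T - a = lab T.rev - b := by
      push_cast
      constructor <;> intro h <;> linear_combination -h
    refine ite_congr (propext this) (fun _ => ?_) fun _ => rfl
    change monom (b, _, T.rev) = _
    congr 3
    change a + 1 + b - 1 - b = a
    omega
  rw [Module.End.mul_apply, LinearMap.add_apply, Module.End.mul_apply, opX_monom, raise_zero,
    opY₀_monom, opY₀_monom, map_sub, map_smul, map_smul, map_sub, ht, ht, hb, comSelf, opOf_monom,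
    opX_monom, raise_zero, wt_zero, wt_one, flip_mk]
  have e1 : lab T - ((a + 1 : ℕ) : ZMod r) = lab T - a - 1 := by
    push_cast
    ring
  have e2 : ((a : ℂ) - (d (lab T) - d (lab T - a))) • monom (a - 1 + 1, b, T) =
      ((a : ℂ) - (d (lab T) - d (lab T - a))) • monom (a + 1 - 1, b, T) := by
    rcases a with _ | a <;> simp
  rw [e1, e2]
  simp only [Nat.add_sub_cancel]
  split_ifs <;> push_cast <;> module

theorem opY₀_opX_one :
    opY₀ lab c₀ d * opX 1 = opX 1 * opY₀ lab c₀ d + comNe lab c₀ 0 := by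
  refine end_ext fun a b T => ?_
  have ht : ∀ n ≤ a + b, opX 1 (tail lab (a, b, T) n) = tail lab (a, b + 1, T) n := by
    intro n hn
    rw [tail, tail, map_sum]
    refine Finset.sum_congr rfl fun m hm => ?_
    have hm' := Finset.mem_range.1 hm
    rw [wt_zero, wt_zero, apply_ite (opX 1), opX_monom, raise_one, map_zero]
    refine ite_congr rfl (fun _ => ?_) fun _ => rfl
    change monom (m, a + b - 1 - m + 1, T.rev) = monom (m, a + (b + 1) - 1 - m, T.rev)
    congr 3
    omega
  have hb : tail lab (a, b + 1, T) (b + 1) = tail lab (a, b + 1, T) b +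
      if lab T.rev - b - (lab T - a) = 1 then monom (b, a, T.rev) else 0 := by
    rw [tail, Finset.sum_range_succ]
    congr 1
    have : lab T.rev - b - 1 = lab T - a ↔ lab T.rev - b - (lab T - a) = 1 := by
      constructor <;> intro h <;> linear_combination h
    refine ite_congr (propext this) (fun _ => ?_) fun _ => rfl
    change monom (b, _, T.rev) = _
    congr 3
    change a + (b + 1) - 1 - b = a
    omega
  rw [Module.End.mul_apply, LinearMap.add_apply, Module.End.mul_apply, opX_monom, raise_one,
    opY₀_monom, opY₀_monom, map_sub, map_smul, map_smul, map_sub, ht _ (by omega),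
    ht _ (by omega), hb, comNe, opOf_monom, opX_monom, raise_one]
  change _ = _ + if wt lab 1 (a, b, T) - wt lab 0 (a, b, T) = 1 then _ else _
  rw [wt_zero, wt_one, flip_mk]
  split_ifs <;> module

theorem comSelf_rev (p : Fin 2) : opS * comSelf lab c₀ d p * opS = comSelf lab c₀ d p.rev := by
  refine end_ext fun a b T => ?_
  rw [Module.End.mul_apply, Module.End.mul_apply, opS_monom, comSelf, comSelf, opOf_monom,
    opOf_monom, map_sub, map_smul, opS_monom, apply_ite opS, map_smul, opS_monom, map_zero,
    flip_flip, wt_flip, wt_flip, wt_flip]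
  congr 1
  exact ite_congr (propext eq_comm) (fun _ => rfl) fun _ => rfl

theorem comNe_rev (p : Fin 2) : opS * comNe lab c₀ p * opS = comNe lab c₀ p.rev := by
  refine end_ext fun a b T => ?_
  rw [Module.End.mul_apply, Module.End.mul_apply, opS_monom, comNe, comNe, opOf_monom,
    opOf_monom, apply_ite opS, map_smul, opS_monom, map_zero, flip_flip, wt_flip, wt_flip]

theorem opY_opX_self (p : Fin 2) :
    opY lab c₀ d p * opX p = opX p * opY lab c₀ d p + comSelf lab c₀ d p := by
  have h : p = 0 ∨ p = 1 := by fin_cases p <;> simp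
  rcases h with rfl | rfl
  · exact opY₀_opX_zero lab c₀ d
  · rw [opY_one, mul_assoc, opS_mul_opX, mul_assoc]
    change opS * (opY₀ lab c₀ d * (opX 0 * opS)) = _
    rw [← mul_assoc (opY₀ lab c₀ d), opY₀_opX_zero, add_mul, mul_add, ← mul_assoc opS,
      ← mul_assoc opS, opS_mul_opX, ← mul_assoc opS, comSelf_rev]
    simp only [mul_assoc]
    rfl

theorem opY_opX_ne (p : Fin 2) :
    opY lab c₀ d p * opX p.rev = opX p.rev * opY lab c₀ d p + comNe lab c₀ p := by
  have h : p = 0 ∨ p = 1 := by fin_cases p <;> simp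
  rcases h with rfl | rfl
  · exact opY₀_opX_one lab c₀ d
  · rw [opY_one, mul_assoc, opS_mul_opX, Fin.rev_rev, mul_assoc, ← mul_assoc (opY₀ lab c₀ d),
      opY₀_opX_one, add_mul, mul_add, ← mul_assoc opS,
      ← mul_assoc opS, opS_mul_opX, ← mul_assoc opS]
    have := comNe_rev lab c₀ 0
    rw [this]
    simp only [mul_assoc]
    rfl

theorem opY_const (p : Fin 2) (T : Fin 2) : opY lab c₀ d p (monom (0, 0, T)) = 0 := by
  have h : p = 0 ∨ p = 1 := by fin_cases p <;> simp
  rcases h with rfl | rfl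
  · simp [opY_zero, opY₀_monom]
  · simp [opY_one, Module.End.mul_apply, opY₀_monom]

/-- An operator that kills the constants and commutes with multiplication by the variables is
zero. -/
theorem eq_zero_of_commute_opX {Z : Module.End ℂ Poly} (h0 : ∀ T, Z (monom (0, 0, T)) = 0)
    (hX : ∀ p, Z * opX p = opX p * Z) : Z = 0 := by
  refine end_ext fun a b T => ?_
  have hX' : ∀ p α, Z (monom (raise p α)) = opX p (Z (monom α)) := fun p α => by
    rw [← opX_monom, ← Module.End.mul_apply, hX, Module.End.mul_apply]
  rw [LinearMap.zero_apply]
  induction a with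
  | zero =>
    induction b with
    | zero => exact h0 T
    | succ b ih => rw [← raise_one, hX', ih, map_zero]
  | succ a ih => rw [← raise_zero, hX', ih, map_zero]

theorem comSelf_eq : comSelf lab c₀ d 0 = opD lab (fun m _ => 1 - (d m - d (m - 1))) -
    opS * opD lab (fun m n => if m = n then c₀ * r else 0) :=
  end_ext fun a b T => by
    rw [comSelf, opOf_monom, LinearMap.sub_apply, Module.End.mul_apply, opD_monom, opD_monom,
      map_smul, opS_monom, ite_smul, zero_smul]

theorem comNe_eq : comNe lab c₀ 1 =
    opS * opD lab (fun m n => if m = n + 1 then c₀ * r else 0) :=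
  end_ext fun a b T => by
    rw [comNe, opOf_monom, Module.End.mul_apply, opD_monom, map_smul, opS_monom, ite_smul,
      zero_smul]
    exact ite_congr (propext sub_eq_iff_eq_add') (fun _ => rfl) fun _ => rfl

/-- The commutator of the Dunkl operators kills constants, so it suffices that it commute with the
variables. For `x₁` this is the Jacobi identity together with a cancellation between the two kinds
of commutators; `x₂` follows by conjugating with `opS`, which changes the sign of the commutator. -/
theorem opY_comm_zero_one :
    opY lab c₀ d 0 * opY lab c₀ d 1 - opY lab c₀ d 1 * opY lab c₀ d 0 = 0 := by
  set Y0 := opY lab c₀ d 0 with hY0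
  set Y1 := opY lab c₀ d 1 with hY1
  have hS0 : opS * Y0 = Y1 * opS := opS_mul_opY lab c₀ d 0
  have hS1 : opS * Y1 = Y0 * opS := opS_mul_opY lab c₀ d 1
  have hX0 : opS * opX 0 = opX 1 * opS := opS_mul_opX 0
  have hX1 : opS * opX 1 = opX 0 * opS := opS_mul_opX 1
  have key : (Y0 * Y1 - Y1 * Y0) * opX 0 = opX 0 * (Y0 * Y1 - Y1 * Y0) := by
    have h1 : Y0 * opX 0 = opX 0 * Y0 + comSelf lab c₀ d 0 := opY_opX_self lab c₀ d 0
    have h2 : Y1 * opX 0 = opX 0 * Y1 + comNe lab c₀ 1 := opY_opX_ne lab c₀ d 1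
    -- The diagonal part of `comSelf` depends on the first weight only and commutes with `Y1`; the
    -- swap parts cancel against `comNe` because each Dunkl operator raises one weight by one.
    have h3 : comSelf lab c₀ d 0 * Y1 - Y1 * comSelf lab c₀ d 0 +
        (Y0 * comNe lab c₀ 1 - comNe lab c₀ 1 * Y0) = 0 := by
      rw [comSelf_eq, comNe_eq, sub_mul, mul_sub, mul_assoc opS, mul_assoc opS,
        opD_mul_opY_one, opD_mul_opY_one, hY0, opY_zero, opD_mul_opY₀, ← opY_zero, ← hY0, ← hY1,
        ← mul_assoc opS, ← mul_assoc opS, hS0, hS1]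
      simp only [add_left_inj, mul_assoc]
      abel
    calc (Y0 * Y1 - Y1 * Y0) * opX 0 = Y0 * (Y1 * opX 0) - Y1 * (Y0 * opX 0) := by
          rw [sub_mul, mul_assoc, mul_assoc]
      _ = (Y0 * opX 0) * Y1 + Y0 * comNe lab c₀ 1 - ((Y1 * opX 0) * Y0 +
          Y1 * comSelf lab c₀ d 0) := by
          rw [h2, h1, mul_add, mul_add, ← mul_assoc, ← mul_assoc, h1, h2]
      _ = opX 0 * (Y0 * Y1 - Y1 * Y0) + (comSelf lab c₀ d 0 * Y1 - Y1 * comSelf lab c₀ d 0 +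
        (Y0 * comNe lab c₀ 1 - comNe lab c₀ 1 * Y0)) := by
          rw [h1, h2, add_mul, add_mul, mul_sub, mul_assoc, mul_assoc]
          abel
      _ = _ := by rw [h3, add_zero]
  have hZ : opS * (Y0 * Y1 - Y1 * Y0) = -((Y0 * Y1 - Y1 * Y0) * opS) := by
    rw [mul_sub, ← mul_assoc, ← mul_assoc, hS0, hS1, mul_assoc, mul_assoc, hS0, hS1, sub_mul,
      mul_assoc, mul_assoc, neg_sub]
  refine eq_zero_of_commute_opX (fun T => ?_) fun p => ?_
  · rw [LinearMap.sub_apply, Module.End.mul_apply, Module.End.mul_apply, hY0, hY1, opY_const,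
      opY_const, map_zero, map_zero, sub_zero]
  · have h : p = 0 ∨ p = 1 := by fin_cases p <;> simp
    rcases h with rfl | rfl
    · exact key
    · have e : opX 1 = opS * opX 0 * opS := by
        rw [hX0, mul_assoc, opS_mul_self, mul_one]
      have hZ' : (Y0 * Y1 - Y1 * Y0) * opS = -(opS * (Y0 * Y1 - Y1 * Y0)) := by
        rw [hZ, neg_neg]
      rw [e, ← mul_assoc, ← mul_assoc, hZ', neg_mul, mul_assoc opS, key, neg_mul,
        mul_assoc, mul_assoc (opX 0), hZ']
      simp only [mul_assoc, mul_neg, neg_neg]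

theorem opY_comm (p q : Fin 2) :
    opY lab c₀ d p * opY lab c₀ d q = opY lab c₀ d q * opY lab c₀ d p := by
  have h := sub_eq_zero.1 (opY_comm_zero_one lab c₀ d)
  fin_cases p <;> fin_cases q
  · rfl
  · exact h
  · exact h.symm
  · rfl

end Dunkl

/-! ### The defining relations hold on polynomials. -/

section Action

variable {r : ℕ} [NeZero r] (ζ : rootsOfUnity r ℂ)

theorem coe_pow_eq_one : ((ζ : ℂˣ) : ℂ) ^ r = 1 := (mem_rootsOfUnity' r (ζ : ℂˣ)).1 ζ.2

theorem mat_zetaElt_pow (p : Fin 2) (l : ℕ) :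
    mat (zetaElt ζ p ^ l) =
      Matrix.diagonal (fun q => if q = p then ((ζ : ℂˣ) : ℂ) ^ l else 1) := by
  induction l with
  | zero => ext a b; simp [mat_one]
  | succ l ih =>
    rw [pow_succ, mat_mul, ih, mat_zetaElt, Matrix.diagonal_mul_diagonal]
    congr 1
    funext q
    split_ifs <;> simp [pow_succ]

theorem mat_refl_zero (l : ℕ) :
    mat (refl ζ 0 l) = !![0, ((ζ : ℂˣ) : ℂ) ^ l; (((ζ : ℂˣ) : ℂ) ^ l)⁻¹, 0] := by
  ext a b
  rw [refl, mat_mul, mat_mul, mat_swapElt]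
  fin_cases a <;> fin_cases b <;>
    simp [Matrix.mul_apply, mat_inv, mat_zetaElt_pow]

theorem mat_refl_one (l : ℕ) :
    mat (refl ζ 1 l) = !![0, (((ζ : ℂˣ) : ℂ) ^ l)⁻¹; ((ζ : ℂˣ) : ℂ) ^ l, 0] := by
  ext a b
  rw [refl, mat_mul, mat_mul, mat_swapElt]
  fin_cases a <;> fin_cases b <;>
    simp [Matrix.mul_apply, mat_inv, mat_zetaElt_pow]

variable (lab : Fin 2 → ZMod r)

theorem opG_refl (p : Fin 2) (l : ℕ) (α : Mon) : opG lab (refl ζ p l) (monom α) =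
    (((ζ : ℂˣ) : ℂ) ^ (wt lab p.rev α - wt lab p α).val) ^ l • monom (flip α) := by
  have h : p = 0 ∨ p = 1 := by fin_cases p <;> simp
  rcases h with rfl | rfl
  · rw [opG_anti _ (by simp [mat_refl_zero]), pow_val_sub (coe_pow_eq_one ζ), mul_pow]
    simp only [mat_refl_zero, Matrix.of_apply, Matrix.cons_val_zero, Matrix.cons_val_one, inv_pow]
    rw [← pow_mul, ← pow_mul, ← pow_mul, ← pow_mul, mul_comm l, mul_comm l]
    rfl
  · rw [opG_anti _ (by simp [mat_refl_one]), pow_val_sub (coe_pow_eq_one ζ), mul_pow]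
    simp only [mat_refl_one, Matrix.of_apply, Matrix.cons_val_zero, Matrix.cons_val_one, inv_pow]
    rw [← pow_mul, ← pow_mul, ← pow_mul, ← pow_mul, mul_comm l, mul_comm l, mul_comm (_⁻¹)]
    rfl

theorem opG_zetaElt_pow (p : Fin 2) (t : ℕ) (α : Mon) : opG lab (zetaElt ζ p ^ t) (monom α) =
    (((ζ : ℂˣ) : ℂ) ^ (wt lab p α).val) ^ t • monom α := by
  have h : p = 0 ∨ p = 1 := by fin_cases p <;> simp
  rcases h with rfl | rfl
  · rw [opG_diag _ (by simp [mat_zetaElt_pow])]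
    simp [mat_zetaElt_pow, ← pow_mul, mul_comm]
  · rw [opG_diag _ (by simp [mat_zetaElt_pow])]
    simp [mat_zetaElt_pow, ← pow_mul, mul_comm]

variable (c₀ : ℂ) (d : ZMod r → ℂ)

/-- The action of the generators of the rational Cherednik algebra on polynomials. -/
def genAct : Gen r → Module.End ℂ Poly
  | Gen.x p => opX p
  | Gen.y p => opY lab c₀ d p
  | Gen.g w => opG lab w

/-- The action of the free algebra on polynomials. -/
def freeAct : Free r →ₐ[ℂ] Module.End ℂ Poly := FreeAlgebra.lift ℂ (genAct lab c₀ d)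

@[simp] theorem freeAct_fx (p : Fin 2) : freeAct lab c₀ d (fx p) = opX p := by
  simp [freeAct, fx, genAct]

@[simp] theorem freeAct_fy (p : Fin 2) : freeAct lab c₀ d (fy p) = opY lab c₀ d p := by
  simp [freeAct, fy, genAct]

@[simp] theorem freeAct_fg (w : W r) : freeAct lab c₀ d (fg w) = opG lab w := by
  simp [freeAct, fg, genAct]

variable {ζ} (hζ : IsPrimitiveRoot ζ r)

theorem coe_isPrimitiveRoot (hζ : IsPrimitiveRoot ζ r) :
    IsPrimitiveRoot ((ζ : ℂˣ) : ℂ) r :=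
  (hζ.map_of_injective (f := (rootsOfUnity r ℂ).subtype) Subtype.val_injective).map_of_injective
    (f := Units.coeHom ℂ) Units.val_injective

include hζ

theorem freeAct_idem (p : Fin 2) (l : ZMod r) (α : Mon) :
    freeAct lab c₀ d (idem ζ p l) (monom α) = if wt lab p α = l then monom α else 0 := by
  have h := coe_isPrimitiveRoot hζ
  have hu := coe_pow_eq_one ζ
  simp only [idem, map_smul, map_sum, freeAct_fg, LinearMap.smul_apply, LinearMap.sum_apply,
    opG_zetaElt_pow, smul_smul, ← Finset.sum_smul]
  have : ∀ t : ℕ, ((ζ : ℂˣ) : ℂ)⁻¹ ^ (t * l.val) * (((ζ : ℂˣ) : ℂ) ^ (wt lab p α).val) ^ t =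
      (((ζ : ℂˣ) : ℂ) ^ (wt lab p α - l).val) ^ t := by
    intro t
    rw [pow_val_sub hu, mul_pow, mul_comm, mul_comm t, pow_mul, inv_pow]
  simp only [this, sum_range_pow_val h, sub_eq_zero]
  split_ifs
  · rw [one_div_mul_cancel (NeZero.ne _), one_smul]
  · rw [mul_zero, zero_smul]

/-- On a weight vector the reflection sums become geometric sums over powers of `ζ`: they give `r`
times the flip when the two weights are equal, or differ by one in the twisted case, and `0`
otherwise. -/
theorem freeAct_rel {A B : Free r} (h : Rel ζ c₀ d A B) :
    freeAct lab c₀ d A = freeAct lab c₀ d B := by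
  have h1 := coe_isPrimitiveRoot hζ
  have hu := coe_pow_eq_one ζ
  induction h with
  | x_comm p q => simp [opX_comm p q]
  | y_comm p q => simp [opY_comm lab c₀ d p q]
  | g_one => simp [opG_one]
  | g_mul u w => simp [opG_mul]
  | g_x w p => simp only [map_mul, map_sum, map_smul, freeAct_fx, freeAct_fg, opG_opX]
  | g_y w p => simp only [map_mul, map_sum, map_smul, freeAct_fy, freeAct_fg, opG_opY]
  | y_x_ne p q hpq =>
    have hq : q = p.rev := by
      revert hpq
      revert p q
      decide
    subst hq
    rw [map_mul, map_add, map_mul, freeAct_fx, freeAct_fy, opY_opX_ne]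
    congr 1
    refine end_ext fun a b T => ?_
    simp only [comNe, opOf_monom, map_smul, map_sum, freeAct_fg, LinearMap.smul_apply,
      LinearMap.sum_apply, opG_refl, smul_smul, ← Finset.sum_smul]
    have : ∀ l : ℕ, ((ζ : ℂˣ) : ℂ)⁻¹ ^ l *
        (((ζ : ℂˣ) : ℂ) ^ (wt lab p.rev (a, b, T) - wt lab p (a, b, T)).val) ^ l =
        (((ζ : ℂˣ) : ℂ) ^ (wt lab p.rev (a, b, T) - wt lab p (a, b, T) - 1).val) ^ l := by
      intro l
      rw [pow_val_sub_one hu, mul_pow]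
    simp only [this, sum_range_pow_val h1, sub_eq_zero (b := (1 : ZMod r))]
    split_ifs
    · rfl
    · rw [mul_zero, zero_smul]
  | y_x_self p =>
    rw [map_mul, map_sub, map_sub, map_add, map_mul, freeAct_fx, freeAct_fy, opY_opX_self,
      add_sub_assoc, add_sub_assoc]
    congr 1
    refine end_ext fun a b T => ?_
    simp only [comSelf, opOf_monom, map_smul, map_sum, freeAct_fg, LinearMap.smul_apply,
      LinearMap.sum_apply, opG_refl, LinearMap.sub_apply, freeAct_idem lab c₀ d hζ, map_one,
      Module.End.one_apply, ← Finset.sum_smul, sum_range_pow_val h1]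
    rw [sub_smul, one_smul]
    simp only [smul_ite, smul_zero, Finset.sum_ite_eq, Finset.mem_univ, if_true]
    congr 1
    have hp : wt lab 0 (a, b, T) = wt lab 1 (a, b, T) ↔
        wt lab p.rev (a, b, T) - wt lab p (a, b, T) = 0 := by
      fin_cases p
      · exact eq_comm.trans sub_eq_zero.symm
      · exact sub_eq_zero.symm
    simp only [hp]
    split_ifs
    · rw [smul_smul]
    · rw [zero_smul, smul_zero]

omit hζ

/-- The action of the rational Cherednik algebra on polynomials. -/
def act (hζ : IsPrimitiveRoot ζ r) : H ζ c₀ d →ₐ[ℂ] Module.End ℂ Poly :=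
  RingQuot.liftAlgHom ℂ ⟨freeAct lab c₀ d, fun _ _ h => freeAct_rel lab c₀ d hζ h⟩

end Action

/-! ### The universal property of standard modules. -/

section StandardModule

variable {r : ℕ} [NeZero r] {ζ : rootsOfUnity r ℂ}

/-- The polynomial space as a module over the rational Cherednik algebra. -/
def Model (_lab : Fin 2 → ZMod r) (_c₀ : ℂ) (_d : ZMod r → ℂ) (_hζ : IsPrimitiveRoot ζ r) : Type :=
  Poly

variable (lab : Fin 2 → ZMod r) (c₀ : ℂ) (d : ZMod r → ℂ) (hζ : IsPrimitiveRoot ζ r)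

instance : AddCommGroup (Model lab c₀ d hζ) := inferInstanceAs (AddCommGroup Poly)

instance : Module ℂ (Model lab c₀ d hζ) := inferInstanceAs (Module ℂ Poly)

instance : Module (H ζ c₀ d) (Model lab c₀ d hζ) :=
  Module.compHom Poly (act lab c₀ d hζ).toRingHom

theorem model_smul_def (h : H ζ c₀ d) (m : Model lab c₀ d hζ) :
    h • m = (act lab c₀ d hζ h m : Poly) := rfl

instance : IsScalarTower ℂ (H ζ c₀ d) (Model lab c₀ d hζ) where
  smul_assoc c h m := by
    rw [model_smul_def, model_smul_def, map_smul]
    rfl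

/-- The element `x_p` of the rational Cherednik algebra. -/
def Hx (ζ : rootsOfUnity r ℂ) (c₀ : ℂ) (d : ZMod r → ℂ) (p : Fin 2) : H ζ c₀ d :=
  RingQuot.mkAlgHom ℂ (Rel ζ c₀ d) (fx p)

/-- The quotient map from the free algebra. -/
def mkH (ζ : rootsOfUnity r ℂ) (c₀ : ℂ) (d : ZMod r → ℂ) : Free r →ₐ[ℂ] H ζ c₀ d :=
  RingQuot.mkAlgHom ℂ (Rel ζ c₀ d)

theorem mkH_rel {A B : Free r} (h : Rel ζ c₀ d A B) : mkH ζ c₀ d A = mkH ζ c₀ d B :=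
  RingQuot.mkAlgHom_rel ℂ h

theorem act_mkH (A : Free r) : act lab c₀ d hζ (mkH ζ c₀ d A) = freeAct lab c₀ d A :=
  RingQuot.liftAlgHom_mkAlgHom_apply ℂ _ _ A

theorem act_Hx (p : Fin 2) : act lab c₀ d hζ (Hx ζ c₀ d p) = opX p :=
  (act_mkH lab c₀ d hζ (fx p)).trans (freeAct_fx lab c₀ d p)

theorem act_Hy (p : Fin 2) : act lab c₀ d hζ (Hy ζ c₀ d p) = opY lab c₀ d p :=
  (act_mkH lab c₀ d hζ (fy p)).trans (freeAct_fy lab c₀ d p)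

theorem act_Hg (w : W r) : act lab c₀ d hζ (Hg ζ c₀ d w) = opG lab w :=
  (act_mkH lab c₀ d hζ (fg w)).trans (freeAct_fg lab c₀ d w)

variable {V : Type} [AddCommGroup V] [Module ℂ V] (ρ : Representation ℂ (W r) V)
  {M : Type*} [AddCommGroup M] [Module ℂ M] [Module (H ζ c₀ d) M] [IsScalarTower ℂ (H ζ c₀ d) M]

variable (ζ) in
/-- The image of a vector in the standard module. -/
def stdMk (v : V) : Standard ζ c₀ d ρ :=
  Submodule.Quotient.mk ((1 : H ζ c₀ d) ⊗ₜ[ℂ] v)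

theorem stdMk_add (v w : V) : (stdMk ζ c₀ d ρ (v + w) : Standard ζ c₀ d ρ) =
    stdMk ζ c₀ d ρ v + stdMk ζ c₀ d ρ w := by
  rw [stdMk, TensorProduct.tmul_add]
  rfl

theorem stdMk_smul (c : ℂ) (v : V) : (stdMk ζ c₀ d ρ (c • v) : Standard ζ c₀ d ρ) =
    c • stdMk ζ c₀ d ρ v := by
  rw [stdMk, TensorProduct.tmul_smul]
  rfl

theorem mk_tmul (h : H ζ c₀ d) (v : V) :
    (Submodule.Quotient.mk (h ⊗ₜ[ℂ] v) : Standard ζ c₀ d ρ) = h • stdMk ζ c₀ d ρ v := by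
  rw [stdMk, ← Submodule.Quotient.mk_smul, TensorProduct.smul_tmul', smul_eq_mul, mul_one]

theorem Hg_smul_stdMk (w : W r) (v : V) :
    Hg ζ c₀ d w • stdMk ζ c₀ d ρ v = stdMk ζ c₀ d ρ (ρ w v) := by
  rw [← mk_tmul, stdMk, Submodule.Quotient.eq]
  exact Submodule.subset_span (Or.inl ⟨w, v, rfl⟩)

theorem Hy_smul_stdMk (p : Fin 2) (v : V) :
    Hy ζ c₀ d p • stdMk ζ c₀ d ρ v = 0 := by
  rw [← mk_tmul, Submodule.Quotient.mk_eq_zero]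
  exact Submodule.subset_span (Or.inr ⟨p, v, rfl⟩)

/-- The universal property of the standard module. -/
def stdLift (g : V →ₗ[ℂ] M) (hg : ∀ w v, Hg ζ c₀ d w • g v = g (ρ w v))
    (hy : ∀ p v, Hy ζ c₀ d p • g v = 0) : Standard ζ c₀ d ρ →ₗ[H ζ c₀ d] M :=
  (indRel ζ c₀ d ρ).liftQ
    (TensorProduct.AlgebraTensorModule.lift (LinearMap.toSpanSingleton (H ζ c₀ d) _ g)) <| by
    rw [indRel, Submodule.span_le]
    rintro m (⟨w, v, rfl⟩ | ⟨p, v, rfl⟩)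
    · simp [hg]
    · simp [hy]

theorem stdLift_stdMk (g : V →ₗ[ℂ] M) (hg : ∀ w v, Hg ζ c₀ d w • g v = g (ρ w v))
    (hy : ∀ p v, Hy ζ c₀ d p • g v = 0) (v : V) :
    stdLift c₀ d ρ g hg hy (stdMk ζ c₀ d ρ v) = g v := by
  rw [stdLift, stdMk, Submodule.liftQ_apply]
  simp

theorem std_induction {P : Standard ζ c₀ d ρ → Prop} (hadd : ∀ m n, P m → P n → P (m + n))
    (h0 : P 0) (hmk : ∀ (h : H ζ c₀ d) v, P (h • stdMk ζ c₀ d ρ v)) (m : Standard ζ c₀ d ρ) : P m := by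
  induction m using Submodule.Quotient.induction_on with
  | H z =>
    induction z with
    | zero => exact h0
    | tmul h v => rw [mk_tmul]; exact hmk h v
    | add x y hx hy => exact hadd _ _ hx hy

theorem std_hom_ext {f g : Standard ζ c₀ d ρ →ₗ[H ζ c₀ d] M}
    (h : ∀ v, f (stdMk ζ c₀ d ρ v) = g (stdMk ζ c₀ d ρ v)) : f = g :=
  LinearMap.ext fun m => std_induction c₀ d ρ (P := fun m => f m = g m)
    (fun m n (hm : _ = _) (hn : _ = _) => by rw [map_add, map_add, hm, hn]) (by rw [map_zero, map_zero])
    (fun a v => by rw [map_smul, map_smul, h]) m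

end StandardModule

/-! ### The standard module is isomorphic to the polynomial model. -/

section Iso

variable {r : ℕ} [NeZero r] {ζ : rootsOfUnity r ℂ} (c₀ : ℂ) (d : ZMod r → ℂ)
  (hζ : IsPrimitiveRoot ζ r) (i j : ZMod r)

/-- The polynomials of degree zero. -/
def constPoly : (Fin 2 → ℂ) →ₗ[ℂ] Poly :=
  (LinearMap.proj 0).smulRight (monom (0, 0, 0)) + (LinearMap.proj 1).smulRight (monom (0, 0, 1))

theorem constPoly_apply (v : Fin 2 → ℂ) :
    constPoly v = v 0 • monom (0, 0, 0) + v 1 • monom (0, 0, 1) := rfl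

theorem opG_constPoly (w : W r) (v : Fin 2 → ℂ) :
    opG ![i, j] w (constPoly v) = constPoly (pairRep i j w v) := by
  rw [constPoly_apply, constPoly_apply, map_add, map_smul, map_smul, pairRep_apply]
  rcases mat_cases w with ⟨h1, h2, h3, h4⟩ | ⟨h1, h2, h3, h4⟩
  · rw [opG_diag _ h1, opG_diag _ h1]
    simp [wt_zero, wt_one, pairMat, Matrix.mulVec, dotProduct, h1, h2, h3, h4, Fin.rev, smul_smul,
      mul_comm]
  · rw [opG_anti _ h3, opG_anti _ h3, add_comm]
    simp [wt_zero, wt_one, pairMat, Matrix.mulVec, dotProduct, h1, h2, h3, h4, Fin.rev, smul_smul,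
      mul_comm]

theorem opY_constPoly (lab : Fin 2 → ZMod r) (p : Fin 2) (v : Fin 2 → ℂ) :
    opY lab c₀ d p (constPoly v) = 0 := by
  rw [constPoly_apply, map_add, map_smul, map_smul, opY_const, opY_const]
  simp

/-- The polynomials of degree zero, in the module over the rational Cherednik algebra. -/
def constModel : (Fin 2 → ℂ) →ₗ[ℂ] Model ![i, j] c₀ d hζ := constPoly

/-- The map from the standard module to polynomials. -/
def toModel : StandardPair ζ c₀ d i j →ₗ[H ζ c₀ d] Model ![i, j] c₀ d hζ :=
  stdLift c₀ d (pairRep i j) (M := Model ![i, j] c₀ d hζ) (constModel c₀ d hζ i j)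
    (fun w v => by rw [model_smul_def, act_Hg]; exact opG_constPoly i j w v)
    (fun p v => by rw [model_smul_def, act_Hy]; exact opY_constPoly c₀ d _ p v)

theorem toModel_stdMk (v : Fin 2 → ℂ) :
    toModel c₀ d hζ i j (stdMk ζ c₀ d (pairRep i j) v) = (constPoly v : Poly) :=
  stdLift_stdMk c₀ d (pairRep i j) (M := Model ![i, j] c₀ d hζ) (constModel c₀ d hζ i j) _ _ v

/-- The map from polynomials to the standard module. -/
def ofPoly : Poly →ₗ[ℂ] StandardPair ζ c₀ d i j :=
  monBasis.constr ℂ fun α => (Hx ζ c₀ d 0 ^ α.1 * Hx ζ c₀ d 1 ^ α.2.1) •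
    stdMk ζ c₀ d (pairRep i j) (Pi.single α.2.2 1)

theorem ofPoly_monom (a b : ℕ) (T : Fin 2) :
    (ofPoly c₀ d i j (monom (a, b, T)) : StandardPair ζ c₀ d i j) =
      (Hx ζ c₀ d 0 ^ a * Hx ζ c₀ d 1 ^ b) • stdMk ζ c₀ d (pairRep i j) (Pi.single T 1) :=
  monBasis.constr_basis ℂ _ _

theorem ofPoly_opX (p : Fin 2) (f : Poly) :
    (ofPoly c₀ d i j (opX p f) : StandardPair ζ c₀ d i j) =
      Hx ζ c₀ d p • ofPoly c₀ d i j f := by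
  have hc : Commute (Hx ζ c₀ d 1) (Hx ζ c₀ d 0) := by
    have := mkH_rel c₀ d (Rel.x_comm (ζ := ζ) 1 0)
    rwa [map_mul, map_mul] at this
  suffices h : ofPoly c₀ d i j ∘ₗ opX p =
      Algebra.lsmul ℂ ℂ (StandardPair ζ c₀ d i j) (Hx ζ c₀ d p) ∘ₗ ofPoly c₀ d i j from
    LinearMap.congr_fun h f
  refine end_ext fun a b T => ?_
  have h : p = 0 ∨ p = 1 := by fin_cases p <;> simp
  rw [LinearMap.comp_apply, LinearMap.comp_apply, opX_monom, Algebra.lsmul_coe]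
  change _ = Hx ζ c₀ d p • ofPoly c₀ d i j (monom (a, b, T))
  rcases h with rfl | rfl
  · rw [raise_zero, ofPoly_monom, ofPoly_monom, smul_smul, pow_succ', mul_assoc]
  · rw [raise_one, ofPoly_monom, ofPoly_monom, smul_smul, pow_succ', ← mul_assoc, ← mul_assoc,
      (hc.pow_right a).eq]

/-- This is the independence half of a PBW statement: the monomials stay independent in the standard
module because they act independently on the model. -/
theorem toModel_ofPoly (f : Poly) : toModel c₀ d hζ i j (ofPoly c₀ d i j f) = f := by
  suffices h : ((toModel c₀ d hζ i j).restrictScalars ℂ) ∘ₗ ofPoly c₀ d i j =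
      (LinearMap.id : Poly →ₗ[ℂ] Poly) from
    LinearMap.congr_fun h f
  refine end_ext fun a b T => ?_
  have hX : ∀ p (m : StandardPair ζ c₀ d i j), toModel c₀ d hζ i j (Hx ζ c₀ d p • m) =
      opX p (toModel c₀ d hζ i j m : Poly) := fun p m => by
    rw [map_smul, model_smul_def, act_Hx]
  change (toModel c₀ d hζ i j (ofPoly c₀ d i j (monom (a, b, T))) : Poly) = monom (a, b, T)
  induction a with
  | zero =>
    induction b with
    | zero =>
      rw [ofPoly_monom, pow_zero, pow_zero, one_mul, one_smul, toModel_stdMk, constPoly_apply]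
      fin_cases T <;> simp <;> rfl
    | succ b ih => rw [← raise_one, ← opX_monom, ofPoly_opX, hX, ih]
  | succ a ih => rw [← raise_zero, ← opX_monom, ofPoly_opX, hX, ih]

theorem stdMk_mem_range (v : Fin 2 → ℂ) :
    stdMk ζ c₀ d (pairRep i j) v ∈ LinearMap.range (ofPoly (ζ := ζ) c₀ d i j) := by
  have hT : ∀ T, stdMk ζ c₀ d (pairRep i j) (Pi.single T 1) ∈
      LinearMap.range (ofPoly (ζ := ζ) c₀ d i j) := fun T => ⟨monom (0, 0, T), by
    rw [ofPoly_monom, pow_zero, pow_zero, one_mul, one_smul]⟩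
  have : v = v 0 • Pi.single 0 1 + v 1 • Pi.single 1 1 := by
    ext p
    fin_cases p <;> simp
  rw [this, stdMk_add, stdMk_smul, stdMk_smul]
  exact add_mem (Submodule.smul_mem _ _ (hT 0)) (Submodule.smul_mem _ _ (hT 1))

theorem poly_induction {P : Poly → Prop} (hadd : ∀ f g, P f → P g → P (f + g))
    (hsmul : ∀ (c : ℂ) f, P f → P (c • f)) (hmon : ∀ a b T, P (monom (a, b, T))) (f : Poly) :
    P f := by
  have hf : f ∈ Submodule.span ℂ (Set.range monBasis) := by
    rw [monBasis.span_eq]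
    trivial
  induction hf using Submodule.span_induction with
  | mem x hx => obtain ⟨α, rfl⟩ := hx; exact hmon α.1 α.2.1 α.2.2
  | zero => rw [← zero_smul ℂ (monom (0, 0, 0))]; exact hsmul _ _ (hmon 0 0 0)
  | add x y _ _ hx hy => exact hadd _ _ hx hy
  | smul c x _ hx => exact hsmul _ _ hx

theorem range_ofPoly_induction {P : StandardPair ζ c₀ d i j → Prop}
    (hadd : ∀ m n, P m → P n → P (m + n)) (hsmul : ∀ (c : ℂ) m, P m → P (c • m))
    (hmk : ∀ v, P (stdMk ζ c₀ d (pairRep i j) v))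
    (hX : ∀ p m, m ∈ LinearMap.range (ofPoly (ζ := ζ) c₀ d i j) → P m → P (Hx ζ c₀ d p • m))
    {m : StandardPair ζ c₀ d i j} (hm : m ∈ LinearMap.range (ofPoly (ζ := ζ) c₀ d i j)) : P m := by
  obtain ⟨f, rfl⟩ := hm
  induction f using poly_induction with
  | hadd f g hf hg => rw [map_add]; exact hadd _ _ hf hg
  | hsmul c f hf => rw [map_smul]; exact hsmul _ _ hf
  | hmon a b T =>
    induction a with
    | zero =>
      induction b with
      | zero => rw [ofPoly_monom, pow_zero, pow_zero, one_mul, one_smul]; exact hmk _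
      | succ b ih => rw [← raise_one, ← opX_monom, ofPoly_opX]; exact hX _ _ ⟨_, rfl⟩ ih
    | succ a ih => rw [← raise_zero, ← opX_monom, ofPoly_opX]; exact hX _ _ ⟨_, rfl⟩ ih

theorem Hx_smul_mem (p : Fin 2) {m : StandardPair ζ c₀ d i j}
    (hm : m ∈ LinearMap.range (ofPoly (ζ := ζ) c₀ d i j)) :
    Hx ζ c₀ d p • m ∈ LinearMap.range (ofPoly (ζ := ζ) c₀ d i j) := by
  obtain ⟨f, rfl⟩ := hm
  exact ⟨opX p f, ofPoly_opX c₀ d i j p f⟩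

theorem Hg_smul_mem (w : W r) {m : StandardPair ζ c₀ d i j}
    (hm : m ∈ LinearMap.range (ofPoly (ζ := ζ) c₀ d i j)) :
    Hg ζ c₀ d w • m ∈ LinearMap.range (ofPoly (ζ := ζ) c₀ d i j) := by
  refine range_ofPoly_induction c₀ d i j (P := fun m => Hg ζ c₀ d w • m ∈ _) (fun m n hm hn => ?_)
    (fun c m hm => ?_) (fun v => ?_) (fun p m hm ih => ?_) hm
  · rw [smul_add]; exact add_mem hm hn
  · rw [smul_comm]; exact Submodule.smul_mem _ _ hm
  · rw [Hg_smul_stdMk]; exact stdMk_mem_range c₀ d i j _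
  · have h : Hg ζ c₀ d w * Hx ζ c₀ d p = (∑ q, mat w⁻¹ p q • Hx ζ c₀ d q) * Hg ζ c₀ d w := by
      have := mkH_rel c₀ d (Rel.g_x (ζ := ζ) w p)
      simp only [map_mul, map_sum, map_smul] at this
      exact this
    rw [smul_smul, h, mul_smul, Finset.sum_smul]
    refine sum_mem fun q _ => ?_
    rw [smul_assoc]
    exact Submodule.smul_mem _ _ (Hx_smul_mem c₀ d i j q ih)

/-- Induction on the degree: moving `y_p` past a variable costs only group elements, which preserve
the span of the monomials. -/
theorem Hy_smul_mem (p : Fin 2) {m : StandardPair ζ c₀ d i j}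
    (hm : m ∈ LinearMap.range (ofPoly (ζ := ζ) c₀ d i j)) :
    Hy ζ c₀ d p • m ∈ LinearMap.range (ofPoly (ζ := ζ) c₀ d i j) := by
  refine range_ofPoly_induction c₀ d i j (P := fun m => Hy ζ c₀ d p • m ∈ _) (fun m n hm hn => ?_)
    (fun c m hm => ?_) (fun v => ?_) (fun q m hm ih => ?_) hm
  · rw [smul_add]; exact add_mem hm hn
  · rw [smul_comm]; exact Submodule.smul_mem _ _ hm
  · rw [Hy_smul_stdMk]; exact zero_mem _
  · have hfg : ∀ w, mkH ζ c₀ d (fg w) • m ∈ LinearMap.range (ofPoly (ζ := ζ) c₀ d i j) :=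
      fun w => Hg_smul_mem c₀ d i j w hm
    have hxy : mkH ζ c₀ d (fx q * fy p) • m ∈ LinearMap.range (ofPoly (ζ := ζ) c₀ d i j) := by
      rw [map_mul, mul_smul]
      exact Hx_smul_mem c₀ d i j q ih
    have hsum : ∀ (s : Finset ℕ) (c : ℕ → ℂ) (w : ℕ → W r),
        mkH ζ c₀ d (∑ l ∈ s, c l • fg (w l)) • m ∈
          LinearMap.range (ofPoly (ζ := ζ) c₀ d i j) := by
      intro s c w
      rw [map_sum, Finset.sum_smul]
      refine sum_mem fun l _ => ?_
      rw [map_smul, smul_assoc]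
      exact Submodule.smul_mem _ _ (hfg _)
    have hyx : Hy ζ c₀ d p • Hx ζ c₀ d q • m = mkH ζ c₀ d (fy p * fx q) • m := by
      rw [map_mul, mul_smul]
      rfl
    rw [hyx]
    by_cases hpq : p = q
    · subst hpq
      rw [mkH_rel c₀ d (Rel.y_x_self p), map_sub, map_sub, map_add, sub_smul, sub_smul, add_smul,
        map_one, one_smul, map_sum, Finset.sum_smul, map_smul, smul_assoc]
      refine sub_mem (sub_mem (add_mem hxy hm) (sum_mem fun l _ => ?_))
        (Submodule.smul_mem _ _ ?_)
      · rw [map_smul, smul_assoc, idem, map_smul, smul_assoc]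
        exact Submodule.smul_mem _ _ (Submodule.smul_mem _ _ (hsum _ _ _))
      · simpa only [one_smul] using hsum (Finset.range r) (fun _ => 1) (refl ζ p)
    · rw [mkH_rel c₀ d (Rel.y_x_ne p q hpq), map_add, add_smul, map_smul, smul_assoc]
      exact add_mem hxy (Submodule.smul_mem _ _ (hsum _ _ _))

theorem mkH_smul_mem (A : Free r) {m : StandardPair ζ c₀ d i j}
    (hm : m ∈ LinearMap.range (ofPoly (ζ := ζ) c₀ d i j)) :
    mkH ζ c₀ d A • m ∈ LinearMap.range (ofPoly (ζ := ζ) c₀ d i j) := by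
  induction A using FreeAlgebra.induction generalizing m with
  | grade0 c =>
    rw [AlgHom.commutes, algebraMap_smul]
    exact Submodule.smul_mem _ _ hm
  | grade1 g =>
    cases g with
    | x p => exact Hx_smul_mem c₀ d i j p hm
    | y p => exact Hy_smul_mem c₀ d i j p hm
    | g w => exact Hg_smul_mem c₀ d i j w hm
  | mul A B hA hB => rw [map_mul, mul_smul]; exact hA (hB hm)
  | add A B hA hB => rw [map_add, add_smul]; exact add_mem (hA hm) (hB hm)

theorem ofPoly_surjective : Function.Surjective (ofPoly (ζ := ζ) c₀ d i j) := fun m =>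
  std_induction c₀ d (pairRep i j)
    (P := fun m => m ∈ LinearMap.range (ofPoly (ζ := ζ) c₀ d i j))
    (fun _ _ hm hn => add_mem hm hn) (zero_mem _) (fun h v => by
      obtain ⟨A, rfl⟩ := RingQuot.mkAlgHom_surjective ℂ (Rel ζ c₀ d) h
      exact mkH_smul_mem c₀ d i j A (stdMk_mem_range c₀ d i j v)) m

theorem toModel_injective : Function.Injective (toModel c₀ d hζ i j) := by
  intro m n h
  obtain ⟨f, rfl⟩ := ofPoly_surjective c₀ d i j m
  obtain ⟨g, rfl⟩ := ofPoly_surjective c₀ d i j n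
  rw [toModel_ofPoly, toModel_ofPoly] at h
  rw [show f = g from h]

end Iso

/-! ### The Dunkl equations on coefficients. -/

section Singular

variable {r : ℕ} [NeZero r] (lab : Fin 2 → ZMod r) (c₀ : ℂ) (d : ZMod r → ℂ)

/-- The coefficient of `x₁^a x₂^b ⊗ v_T`. -/
def coef (α : Mon) : Poly →ₗ[ℂ] ℂ := monBasis.coord α

theorem coef_monom (α β : Mon) : coef α (monom β) = if β = α then 1 else 0 := by
  rw [coef, monom, Module.Basis.coord_apply, Module.Basis.repr_self, Finsupp.single_apply]

theorem poly_ext {f g : Poly} (h : ∀ a b T, coef (a, b, T) f = coef (a, b, T) g) : f = g :=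
  monBasis.ext_elem fun α => h α.1 α.2.1 α.2.2

theorem coef_opS (α : Mon) (f : Poly) : coef α (opS f) = coef (flip α) f := by
  induction f using poly_induction with
  | hadd f g hf hg => rw [map_add, map_add, map_add, hf, hg]
  | hsmul c f hf => rw [map_smul, map_smul, map_smul, hf]
  | hmon a b T =>
    rw [opS_monom, coef_monom, coef_monom]
    refine ite_congr (propext ⟨fun h => ?_, fun h => ?_⟩) (fun _ => rfl) fun _ => rfl
    · rw [← h, flip_flip]
    · rw [h, flip_flip]

theorem coef_opD (φ : ZMod r → ZMod r → ℂ) (α : Mon) (f : Poly) :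
    coef α (opD lab φ f) = φ (wt lab 0 α) (wt lab 1 α) * coef α f := by
  induction f using poly_induction with
  | hadd f g hf hg => rw [map_add, map_add, map_add, hf, hg, mul_add]
  | hsmul c f hf => rw [map_smul, map_smul, map_smul, hf, smul_eq_mul, smul_eq_mul, mul_left_comm]
  | hmon a b T =>
    rw [opD_monom, map_smul, coef_monom, smul_eq_mul]
    split_ifs with h
    · rw [h]
    · rw [mul_zero, mul_zero]

/-- The polynomials of a given weight. -/
def weightSpace (m n : ZMod r) : Submodule ℂ Poly where
  carrier := {f | ∀ α, coef α f ≠ 0 → wt lab 0 α = m ∧ wt lab 1 α = n}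
  add_mem' := by
    intro f g hf hg α hα
    rw [map_add] at hα
    by_cases h : coef α f = 0
    · rw [h, zero_add] at hα
      exact hg α hα
    · exact hf α h
  zero_mem' := fun α h => absurd (map_zero _) h
  smul_mem' := by
    intro c f hf α hα
    rw [map_smul] at hα
    exact hf α (right_ne_zero_of_smul hα)

variable {lab} in
theorem opD_of_mem {m n : ZMod r} {f : Poly} (hf : f ∈ weightSpace lab m n)
    (φ : ZMod r → ZMod r → ℂ) : opD lab φ f = φ m n • f := by
  refine poly_ext fun a b T => ?_
  rw [coef_opD, map_smul, smul_eq_mul]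
  by_cases h : coef (a, b, T) f = 0
  · rw [h, mul_zero, mul_zero]
  · rw [(hf _ h).1, (hf _ h).2]

variable {lab} in
theorem opS_mem {m n : ZMod r} {f : Poly} (hf : f ∈ weightSpace lab m n) :
    opS f ∈ weightSpace lab n m := by
  intro α hα
  rw [coef_opS] at hα
  have := hf _ hα
  rw [wt_flip, wt_flip] at this
  exact ⟨this.2, this.1⟩

/-- The polynomials of a given weight killed by the Dunkl operators. -/
def singular (m n : ZMod r) : Submodule ℂ Poly :=
  weightSpace lab m n ⊓ ⨅ p, LinearMap.ker (opY lab c₀ d p)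

theorem mem_singular {m n : ZMod r} {f : Poly} :
    f ∈ singular lab c₀ d m n ↔ f ∈ weightSpace lab m n ∧ ∀ p, opY lab c₀ d p f = 0 := by
  simp [singular, Submodule.mem_inf]

theorem coef_tail (a' b' : ℕ) (T' : Fin 2) (a b : ℕ) (T : Fin 2) (n : ℕ) (hn : n ≤ a' + b') :
    coef (a, b, T) (tail lab (a', b', T') n) =
      if a < n ∧ a' + b' = a + b + 1 ∧ T' = T.rev ∧ wt lab 0 (a', b', T') = lab T - a - 1
      then 1 else 0 := by
  rw [tail, map_sum]
  simp only [apply_ite (coef (a, b, T)), map_zero, coef_monom]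
  by_cases ha : a < n
  · rw [Finset.sum_eq_single_of_mem a (Finset.mem_range.2 ha)
      (fun m _ hm => by
        split_ifs with h1 h2
        · exact absurd (congrArg Prod.fst h2) hm
        · rfl
        · rfl), ← ite_and]
    refine ite_congr (propext ?_) (fun _ => rfl) fun _ => rfl
    simp only [Prod.mk.injEq, true_and]
    constructor
    · rintro ⟨h1, h2, rfl⟩
      refine ⟨ha, by omega, (Fin.rev_rev T').symm, h1.symm⟩
    · rintro ⟨-, h2, rfl, h4⟩
      refine ⟨?_, by omega, Fin.rev_rev T⟩
      rw [h4, Fin.rev_rev]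
  · rw [if_neg (fun h => ha h.1)]
    refine Finset.sum_eq_zero fun m hm => ?_
    split_ifs with h1 h2
    · have h3 : m = a := congrArg Prod.fst h2
      exact absurd (Finset.mem_range.1 hm) (h3 ▸ ha)
    · rfl
    · rfl

theorem sum_ite_fst (P : Mon → Prop) [DecidablePred P] (a b N : ℕ) (T T' : Fin 2) (u : ℕ)
    (hu : u ≤ N + 1) :
    (∑ n ∈ Finset.range u, if P (n, N - n, T') then
      coef (n, N - n, T') (monom (a, b, T)) else 0) =
      if a < u ∧ a + b = N ∧ T = T' ∧ P (a, b, T) then 1 else 0 := by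
  simp only [coef_monom, ← ite_and]
  by_cases h : a < u ∧ a + b = N ∧ T = T' ∧ P (a, b, T)
  · obtain ⟨h1, h2, rfl, h4⟩ := h
    have e : N - a = b := by omega
    rw [if_pos ⟨h1, h2, rfl, h4⟩, Finset.sum_eq_single_of_mem a (Finset.mem_range.2 h1), e,
      if_pos ⟨h4, rfl⟩]
    intro n _ hn
    exact if_neg fun h => hn (congrArg Prod.fst h.2).symm
  · rw [if_neg h]
    refine Finset.sum_eq_zero fun n hn => if_neg fun hP => h ?_
    have hn' := Finset.mem_range.1 hn
    obtain ⟨hP, he⟩ := hP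
    rw [← he] at hP
    simp only [Prod.mk.injEq] at he
    exact ⟨by omega, by omega, he.2.2, hP⟩

theorem sum_ite_snd (P : Mon → Prop) [DecidablePred P] (a b N : ℕ) (T T' : Fin 2) (u : ℕ)
    (hu : u ≤ N + 1) :
    (∑ n ∈ Finset.range u, if P (N - n, n, T') then
      coef (N - n, n, T') (monom (a, b, T)) else 0) =
      if b < u ∧ a + b = N ∧ T = T' ∧ P (a, b, T) then 1 else 0 := by
  simp only [coef_monom, ← ite_and]
  by_cases h : b < u ∧ a + b = N ∧ T = T' ∧ P (a, b, T)
  · obtain ⟨h1, h2, rfl, h4⟩ := h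
    have e : N - b = a := by omega
    rw [if_pos ⟨h1, h2, rfl, h4⟩, Finset.sum_eq_single_of_mem b (Finset.mem_range.2 h1), e,
      if_pos ⟨h4, rfl⟩]
    intro n _ hn
    exact if_neg fun h => hn (congrArg (fun α : Mon => α.2.1) h.2).symm
  · rw [if_neg h]
    refine Finset.sum_eq_zero fun n hn => if_neg fun hP => h ?_
    have hn' := Finset.mem_range.1 hn
    obtain ⟨hP, he⟩ := hP
    rw [← he] at hP
    simp only [Prod.mk.injEq] at he
    exact ⟨by omega, by omega, he.2.2, hP⟩

/-- A monomial `x₁^{a'} x₂^{b'}` contributes `[a < a'] - [a < b']`, which equals `[b' ≤ a] - [a' ≤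
a]`; hence two initial sums of the same length `a + 1`. -/
theorem coef_opY₀_aux (f : Poly) (a b : ℕ) (T : Fin 2) :
    coef (a, b, T) (opY₀ lab c₀ d f) =
      ((a : ℂ) + 1 - (d (lab T) - d (lab T - a - 1))) * coef (a + 1, b, T) f -
      c₀ * r * ((∑ n ∈ Finset.range (a + 1),
        if wt lab 0 (a + b + 1 - n, n, T.rev) = lab T - a - 1 then
          coef (a + b + 1 - n, n, T.rev) f else 0) -
        ∑ n ∈ Finset.range (a + 1), if wt lab 0 (n, a + b + 1 - n, T.rev) = lab T - a - 1 then
          coef (n, a + b + 1 - n, T.rev) f else 0) := by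
  induction f using poly_induction with
  | hadd f g hf hg =>
    have h : ∀ (P : Prop) [Decidable P] (x y : ℂ),
        (if P then x + y else 0) = (if P then x else 0) + if P then y else 0 := by
      intro P _ x y
      split_ifs <;> simp
    simp only [map_add, hf, hg, h, Finset.sum_add_distrib]
    ring
  | hsmul c f hf =>
    have h : ∀ (P : Prop) [Decidable P] (x : ℂ),
        (if P then c * x else 0) = c * (if P then x else 0) := by
      intro P _ x
      split_ifs <;> simp
    simp only [map_smul, smul_eq_mul, hf, h, ← Finset.mul_sum]
    ring
  | hmon a' b' T' =>
    rw [sum_ite_fst (fun α => wt lab 0 α = lab T - a - 1) a' b' _ T' _ _ (by omega),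
      sum_ite_snd (fun α => wt lab 0 α = lab T - a - 1) a' b' _ T' _ _ (by omega),
      opY₀_monom, map_sub, map_smul, map_smul, map_sub, coef_tail _ _ _ _ _ _ _ _ (by omega),
      coef_tail _ _ _ _ _ _ _ _ (by omega), smul_eq_mul, smul_eq_mul, coef_monom, coef_monom]
    congr 1
    · rcases a' with _ | a'
      · simp
      · rw [Nat.add_sub_cancel]
        have : (a', b', T') = (a, b, T) ↔ (a' + 1, b', T') = (a + 1, b, T) := by simp
        simp only [this]
        split_ifs with h
        · simp only [Prod.mk.injEq, add_left_inj] at h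
          obtain ⟨rfl, rfl, rfl⟩ := h
          push_cast
          rw [sub_sub (lab T')]
        · simp
    · congr 1
      by_cases h : a' + b' = a + b + 1 ∧ T' = T.rev ∧ wt lab 0 (a', b', T') = lab T - a - 1
      · have hP : ∀ q : Prop, (q ∧ a' + b' = a + b + 1 ∧ T' = T.rev ∧
            wt lab 0 (a', b', T') = lab T - a - 1) ↔ q := fun q => and_iff_left h
        simp only [hP]
        rcases lt_or_ge a a' with h1 | h1 <;> rcases lt_or_ge a b' with h2 | h2
        · rw [if_pos h1, if_pos h2, if_neg (by omega), if_neg (by omega), sub_self, sub_self]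
        · rw [if_pos h1, if_neg (by omega), if_pos (by omega), if_neg (by omega)]
        · rw [if_neg (by omega), if_pos h2, if_neg (by omega), if_pos (by omega)]
        · rw [if_neg (by omega), if_neg (by omega), if_pos (by omega), if_pos (by omega), sub_self,
            sub_self]
      · simp only [h, and_false, if_false]

/-- The alternating partial sum of coefficients in degree `N`. -/
def altSum (f : Poly) (N : ℕ) (T : Fin 2) (u : ℕ) : ℂ :=
  ∑ n ∈ Finset.range u, (coef (N - n, n, T) f - coef (n, N - n, T) f)

variable {lab} {m n : ZMod r} {f : Poly}

theorem coef_opY_zero (hf : f ∈ weightSpace lab m n) {a b : ℕ} {T : Fin 2}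
    (ha : lab T - a - 1 = m) :
    coef (a, b, T) (opY lab c₀ d 0 f) =
      ((a : ℂ) + 1 - (d (lab T) - d m)) * coef (a + 1, b, T) f -
        c₀ * r * altSum f (a + b + 1) T.rev (a + 1) := by
  have h : ∀ α, (if wt lab 0 α = m then coef α f else 0) = coef α f := by
    intro α
    split_ifs with h
    · rfl
    · by_contra h'
      exact h (hf α (Ne.symm h')).1
  rw [opY_zero, coef_opY₀_aux, ha]
  simp only [h, altSum, Finset.sum_sub_distrib]

theorem coef_opY_one (hf : f ∈ weightSpace lab m n) {a b : ℕ} {T : Fin 2}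
    (hb : lab T.rev - b - 1 = n) :
    coef (a, b, T) (opY lab c₀ d 1 f) =
      ((b : ℂ) + 1 - (d (lab T.rev) - d n)) * coef (a, b + 1, T) f +
        c₀ * r * altSum f (a + b + 1) T.rev (b + 1) := by
  have hS := coef_opY_zero c₀ d (opS_mem hf) (a := b) (b := a) (T := T.rev) hb
  rw [opY_one, Module.End.mul_apply, Module.End.mul_apply, coef_opS, flip_mk, ← opY_zero, hS,
    coef_opS, flip_mk, Fin.rev_rev, sub_eq_add_neg, ← mul_neg, add_comm b a]
  congr 2
  simp only [altSum, ← Finset.sum_neg_distrib, coef_opS, flip_mk, neg_sub]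

theorem opY_zero_mem (hf : f ∈ weightSpace lab m n) :
    opY lab c₀ d 0 f ∈ weightSpace lab (m + 1) n := by
  intro α hα
  have hf' : f = opD lab (fun m' n' => if m' = m ∧ n' = n then 1 else 0) f := by
    rw [opD_of_mem hf, if_pos ⟨rfl, rfl⟩, one_smul]
  have h : opY lab c₀ d 0 f =
      opD lab (fun m' n' => if m' = m + 1 ∧ n' = n then 1 else 0) (opY lab c₀ d 0 f) := by
    rw [← Module.End.mul_apply, opY_zero, opD_mul_opY₀, Module.End.mul_apply]
    simp only [add_left_inj]
    rw [← hf']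
  rw [h, coef_opD] at hα
  by_contra hc
  rw [if_neg hc, zero_mul] at hα
  exact hα rfl

theorem opY_one_mem (hf : f ∈ weightSpace lab m n) :
    opY lab c₀ d 1 f ∈ weightSpace lab m (n + 1) := by
  rw [opY_one, mul_assoc, Module.End.mul_apply, Module.End.mul_apply]
  exact opS_mem (opY_zero_mem c₀ d (opS_mem hf))

/-- The full sum is its own negative, hence zero; a prefix is then minus the complementary suffix,
which reflects back to a prefix. -/
theorem sum_range_antisymm {h : ℕ → ℂ} {N : ℕ} (hN : ∀ n ≤ N, h (N - n) = -h n) {u : ℕ}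
    (hu : u ≤ N + 1) :
    ∑ n ∈ Finset.range (N + 1 - u), h n = ∑ n ∈ Finset.range u, h n := by
  induction u with
  | zero =>
    have h1 := Finset.sum_range_reflect h (N + 1)
    have h2 : ∑ j ∈ Finset.range (N + 1), h (N + 1 - 1 - j) =
        -∑ j ∈ Finset.range (N + 1), h j := by
      rw [← Finset.sum_neg_distrib]
      refine Finset.sum_congr rfl fun j hj => ?_
      rw [Nat.add_sub_cancel, hN j (by have := Finset.mem_range.1 hj; omega)]
    rw [h2] at h1
    rw [Finset.range_zero, Finset.sum_empty, Nat.sub_zero]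
    linear_combination (-1 / 2 : ℂ) * h1
  | succ u ih =>
    have ih := ih (by omega)
    rw [show N + 1 - u = N - u + 1 by omega, Finset.sum_range_succ, hN u (by omega)] at ih
    rw [Finset.sum_range_succ, show N + 1 - (u + 1) = N - u by omega]
    linear_combination ih

/-- This identity makes the equations of the two Dunkl operators agree: one involves the sum up to
`a`, the other the sum up to `b`. -/
theorem altSum_symm {a b N : ℕ} (hN : a + b = N) {T : Fin 2} (h1 : coef (a, b, T) f = 0)
    (h2 : coef (b, a, T) f = 0) : altSum f N T b = altSum f N T a := by
  have h := sum_range_antisymm (h := fun n => coef (N - n, n, T) f - coef (n, N - n, T) f) (N := N)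
    (fun n hn => by simp only [Nat.sub_sub_self hn, neg_sub]) (u := a) (by omega)
  rw [show N + 1 - a = b + 1 by omega, Finset.sum_range_succ, show N - b = a by omega, h1, h2,
    sub_zero, add_zero] at h
  exact h

end Singular

/-! ### Homomorphisms of standard modules as singular polynomials. -/

section Hom

variable {r : ℕ} [NeZero r] {ζ : rootsOfUnity r ℂ} (c₀ : ℂ) (d : ZMod r → ℂ)
  (hζ : IsPrimitiveRoot ζ r) (i j k : ZMod r)

theorem mem_weightSpace_of_zeta (hζ : IsPrimitiveRoot ζ r) {lab : Fin 2 → ZMod r} {m n : ZMod r}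
    {f : Poly}
    (h0 : opG lab (zetaElt ζ 0) f = ((ζ : ℂˣ) : ℂ) ^ m.val • f)
    (h1 : opG lab (zetaElt ζ 1) f = ((ζ : ℂˣ) : ℂ) ^ n.val • f) : f ∈ weightSpace lab m n := by
  have hu := coe_isPrimitiveRoot hζ
  intro α hα
  rw [opG_eq_opD _ (by simp [mat_zetaElt])] at h0 h1
  have e0 := congrArg (coef α) h0
  have e1 := congrArg (coef α) h1
  rw [coef_opD, map_smul, smul_eq_mul] at e0 e1
  have e0 := mul_right_cancel₀ hα e0
  have e1 := mul_right_cancel₀ hα e1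
  simp only [mat_zetaElt, Matrix.diagonal_apply_eq, if_true, one_ne_zero, zero_ne_one, if_false,
    one_pow, mul_one, one_mul] at e0 e1
  exact ⟨pow_val_inj hu e0, pow_val_inj hu e1⟩

/-- A homomorphism of standard modules, evaluated on the first basis vector. -/
def evalHom : (StandardPair ζ c₀ d i k →ₗ[H ζ c₀ d] StandardPair ζ c₀ d i j) →ₗ[ℂ] Poly where
  toFun φ := (toModel c₀ d hζ i j (φ (stdMk ζ c₀ d (pairRep i k) ![1, 0])) : Poly)
  map_add' φ ψ := by rw [LinearMap.add_apply, map_add]; rfl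
  map_smul' c φ := by
    rw [LinearMap.smul_apply]
    exact ((toModel c₀ d hζ i j).restrictScalars ℂ).map_smul c _

/-- The vector `v_{T₁}` and its image under the transposition span the representation, which
generates the standard module. -/
theorem evalHom_injective : Function.Injective (evalHom c₀ d hζ i j k) := by
  rw [← LinearMap.ker_eq_bot, LinearMap.ker_eq_bot']
  intro φ hφ
  have h0 : φ (stdMk ζ c₀ d (pairRep i k) ![1, 0]) = 0 :=
    toModel_injective c₀ d hζ i j (hφ.trans (map_zero _).symm)
  have h1 : φ (stdMk ζ c₀ d (pairRep i k) ![0, 1]) = 0 := by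
    rw [← (pairRep_swap i k).1, ← Hg_smul_stdMk, map_smul, h0, smul_zero]
  refine std_hom_ext c₀ d _ fun v => ?_
  have : v = v 0 • ![1, 0] + v 1 • ![0, 1] := by
    ext p
    fin_cases p <;> simp
  rw [this, stdMk_add, stdMk_smul, stdMk_smul]
  have hs : ∀ (c : ℂ) m, φ (c • m) = c • φ m := (φ.restrictScalars ℂ).map_smul
  rw [map_add, hs, hs, h0, h1]
  simp

theorem evalHom_mem (φ : StandardPair ζ c₀ d i k →ₗ[H ζ c₀ d] StandardPair ζ c₀ d i j) :
    evalHom c₀ d hζ i j k φ ∈ singular ![i, j] c₀ d i k := by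
  have hs : ∀ (c : ℂ) m, toModel c₀ d hζ i j (φ (c • m)) =
      (c • (toModel c₀ d hζ i j (φ m) : Poly) : Poly) :=
    (((toModel c₀ d hζ i j).comp φ).restrictScalars ℂ).map_smul
  have hg : ∀ w v, opG ![i, j] w (toModel c₀ d hζ i j (φ (stdMk ζ c₀ d (pairRep i k) v))) =
      (toModel c₀ d hζ i j (φ (stdMk ζ c₀ d (pairRep i k) (pairRep i k w v))) : Poly) := by
    intro w v
    rw [← Hg_smul_stdMk, map_smul, map_smul, model_smul_def, act_Hg]
  rw [mem_singular]
  constructor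
  · refine mem_weightSpace_of_zeta hζ ?_ ?_
    · change opG _ _ (toModel c₀ d hζ i j _) = _
      rw [hg, (pairRep_zeta_one ζ i k).1, stdMk_smul, hs]
      rfl
    · change opG _ _ (toModel c₀ d hζ i j _) = _
      rw [hg, (pairRep_zeta_two ζ i k).1, stdMk_smul, hs]
      rfl
  · intro p
    change opY _ _ _ _ (toModel c₀ d hζ i j _) = _
    rw [← act_Hy ![i, j] c₀ d hζ p, ← model_smul_def, ← map_smul, ← map_smul, Hy_smul_stdMk,
      map_zero, map_zero]
    rfl

/-- The `W`-equivariant map attached to a singular polynomial. -/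
def singMap (f : Poly) : (Fin 2 → ℂ) →ₗ[ℂ] Poly :=
  (LinearMap.proj 0).smulRight f + (LinearMap.proj 1).smulRight (opS f)

theorem singMap_apply (f : Poly) (v : Fin 2 → ℂ) : singMap f v = v 0 • f + v 1 • opS f := rfl

theorem opG_singMap {f : Poly} (hf : f ∈ weightSpace ![i, j] i k) (w : W r) (v : Fin 2 → ℂ) :
    opG ![i, j] w (singMap f v) = singMap f (pairRep i k w v) := by
  have hS : opS (opS f) = f := by rw [← Module.End.mul_apply, opS_mul_self]; rfl
  rw [singMap_apply, singMap_apply, map_add, map_smul, map_smul, pairRep_apply]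
  rcases mat_cases w with ⟨h1, h2, h3, h4⟩ | ⟨h1, h2, h3, h4⟩
  · rw [opG_eq_opD _ h1, opD_of_mem hf, opD_of_mem (opS_mem hf)]
    simp [pairMat, Matrix.mulVec, dotProduct, h1, h2, h3, h4, Fin.rev, smul_smul, mul_comm]
  · rw [opG_eq_opS _ h3, Module.End.mul_apply, Module.End.mul_apply, opD_of_mem hf,
      opD_of_mem (opS_mem hf), map_smul, map_smul, hS, add_comm]
    simp [pairMat, Matrix.mulVec, dotProduct, h1, h2, h3, h4, Fin.rev, smul_smul, mul_comm]

theorem opY_singMap {f : Poly} (hf : ∀ p, opY ![i, j] c₀ d p f = 0) (p : Fin 2)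
    (v : Fin 2 → ℂ) : opY ![i, j] c₀ d p (singMap f v) = 0 := by
  have h : opY ![i, j] c₀ d p (opS f) = 0 := by
    have := opS_mul_opY ![i, j] c₀ d p.rev
    rw [Fin.rev_rev] at this
    rw [← Module.End.mul_apply, ← this, Module.End.mul_apply, hf, map_zero]
  rw [singMap_apply, map_add, map_smul, map_smul, hf, h, smul_zero, smul_zero, add_zero]

/-- A singular `f` extends by `v_{T₁} ↦ f`, `v_{T₂} ↦ opS f`; the conditions of the universal
property are checked in the model, where `toModel` is injective. -/
theorem range_evalHom : LinearMap.range (evalHom c₀ d hζ i j k) = singular ![i, j] c₀ d i k := by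
  refine le_antisymm ?_ fun f hf => ?_
  · rintro _ ⟨φ, rfl⟩
    exact evalHom_mem c₀ d hζ i j k φ
  · rw [mem_singular] at hf
    refine ⟨stdLift c₀ d (pairRep i k) (ofPoly c₀ d i j ∘ₗ singMap f) (fun w v => ?_)
      fun p v => ?_, ?_⟩
    · refine toModel_injective c₀ d hζ i j ?_
      rw [map_smul, LinearMap.comp_apply, LinearMap.comp_apply, toModel_ofPoly, toModel_ofPoly]
      change act ![i, j] c₀ d hζ (Hg ζ c₀ d w) _ = _
      rw [act_Hg]
      exact opG_singMap i j k hf.1 w v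
    · refine toModel_injective c₀ d hζ i j ?_
      rw [map_smul, LinearMap.comp_apply, toModel_ofPoly, map_zero]
      change act ![i, j] c₀ d hζ (Hy ζ c₀ d p) _ = 0
      rw [act_Hy]
      exact opY_singMap c₀ d i j hf.2 p v
    · change (toModel c₀ d hζ i j _ : Poly) = f
      rw [stdLift_stdMk, LinearMap.comp_apply, toModel_ofPoly, singMap_apply]
      simp
      rfl

include hζ in
theorem finrank_hom :
    Module.finrank ℂ (StandardPair ζ c₀ d i k →ₗ[H ζ c₀ d] StandardPair ζ c₀ d i j) =
      Module.finrank ℂ (singular ![i, j] c₀ d i k) := by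
  rw [← range_evalHom c₀ d hζ i j k]
  exact (LinearEquiv.ofInjective _ (evalHom_injective c₀ d hζ i j k)).finrank_eq

end Hom

/-! ### A terminating balanced series and its recurrences. -/

section Hypergeometric

/-- The rising factorial `(x)_n`. -/
def poch (x : ℂ) (n : ℕ) : ℂ := ∏ m ∈ Finset.range n, (x + m)

theorem poch_succ (x : ℂ) (n : ℕ) : poch x (n + 1) = poch x n * (x + n) :=
  Finset.prod_range_succ _ _

theorem poch_succ' (x : ℂ) (n : ℕ) : poch x (n + 1) = x * poch (x + 1) n := by
  rw [poch, Finset.prod_range_succ', mul_comm, poch]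
  simp only [Nat.cast_zero, add_zero, Nat.cast_add, Nat.cast_one, add_assoc, add_comm (1 : ℂ)]

theorem mul_poch_add_one (x : ℂ) (n : ℕ) : x * poch (x + 1) n = (x + n) * poch x n := by
  rw [← poch_succ', poch_succ, mul_comm]

theorem poch_neg_eq_zero {k n : ℕ} (h : k < n) : poch (-(k : ℂ)) n = 0 :=
  Finset.prod_eq_zero (Finset.mem_range.2 h) (neg_add_cancel _)

/-- The coefficients `(c)_n (-c)_n / (n!² (-a)_n (-b)_n)`. -/
def racahCoeff (c a b : ℂ) (n : ℕ) : ℂ :=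
  ∏ m ∈ Finset.range n, ((m : ℂ) ^ 2 - c ^ 2) / (((m : ℂ) + 1) ^ 2 * ((m - a) * (m - b)))

theorem racahCoeff_succ {c a b : ℂ} {n : ℕ} (ha : (n : ℂ) ≠ a) (hb : (n : ℂ) ≠ b) :
    racahCoeff c a b (n + 1) * ((n : ℂ) + 1) ^ 2 * ((n - a) * (n - b)) =
      racahCoeff c a b n * ((n : ℂ) ^ 2 - c ^ 2) := by
  have h1 : (n : ℂ) - a ≠ 0 := sub_ne_zero.2 ha
  have h2 : (n : ℂ) - b ≠ 0 := sub_ne_zero.2 hb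
  have h3 : (n : ℂ) + 1 ≠ 0 := Nat.cast_add_one_ne_zero n
  rw [racahCoeff, racahCoeff, Finset.prod_range_succ]
  field_simp

/-- The sum telescopes: each new term is `-c²/(M+1)²` times the product reached so far. -/
theorem sum_prod_div (c : ℂ) (M : ℕ) :
    ∑ n ∈ Finset.range (M + 1),
      ∏ m ∈ Finset.range n, ((m : ℂ) ^ 2 - c ^ 2) / ((m : ℂ) + 1) ^ 2 =
        ∏ m ∈ Finset.range M, (1 - c ^ 2 / ((m : ℂ) + 1) ^ 2) := by
  have h : ∀ M : ℕ, ∏ m ∈ Finset.range (M + 1), ((m : ℂ) ^ 2 - c ^ 2) / ((m : ℂ) + 1) ^ 2 =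
      -(c ^ 2 / ((M : ℂ) + 1) ^ 2) * ∏ m ∈ Finset.range M, (1 - c ^ 2 / ((m : ℂ) + 1) ^ 2) := by
    intro M
    induction M with
    | zero => simp
    | succ M ih =>
      rw [Finset.prod_range_succ, ih, Finset.prod_range_succ]
      have h1 : (M : ℂ) + 1 ≠ 0 := Nat.cast_add_one_ne_zero M
      have h2 : (M : ℂ) + 1 + 1 ≠ 0 := by exact_mod_cast Nat.cast_add_one_ne_zero (R := ℂ) (M + 1)
      push_cast
      field_simp
  induction M with
  | zero => simp
  | succ M ih => rw [Finset.sum_range_succ, ih, h, Finset.prod_range_succ]; ring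

variable (c : ℂ) (a b : ℕ)

/-- A terminating balanced hypergeometric sum, with `M` terms. -/
def racah (M k : ℕ) : ℂ := ∑ n ∈ Finset.range M,
  racahCoeff c a b n * (poch (-(k : ℂ)) n * poch ((k : ℂ) - (a + b)) n)

/-- The sum accompanying `racah` in the system of recurrences. -/
def racahDual (M k : ℕ) : ℂ := ∑ n ∈ Finset.range M,
  n * racahCoeff c a b n * (poch (-(k : ℂ)) n * poch ((k : ℂ) - 1 - (a + b)) n)

theorem racah_zero (M : ℕ) (hM : 0 < M) : racah c a b M 0 = 1 := by
  rw [racah, Finset.sum_eq_single_of_mem 0 (Finset.mem_range.2 hM)]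
  · simp [racahCoeff, poch]
  · intro n _ hn
    rw [poch_neg_eq_zero (Nat.pos_of_ne_zero hn), zero_mul, mul_zero]

theorem racahDual_zero (M : ℕ) : racahDual c a b M 0 = 0 := by
  refine Finset.sum_eq_zero fun n _ => ?_
  rcases n with _ | n
  · simp
  · rw [poch_neg_eq_zero (Nat.succ_pos n), zero_mul, mul_zero]

/-- The identity holds term by term, by the contiguity relation `mul_poch_add_one` for each of the
two rising factorials. -/
theorem racah_succ_sub (M k : ℕ) :
    ((a : ℂ) + b - k) * (k + 1) * (racah c a b M (k + 1) - racah c a b M k) =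
      ((a : ℂ) + b - 2 * k - 1) * racahDual c a b M (k + 1) := by
  rw [racah, racah, racahDual, ← Finset.sum_sub_distrib, Finset.mul_sum, Finset.mul_sum]
  refine Finset.sum_congr rfl fun n _ => ?_
  have h1 := mul_poch_add_one (-((k + 1 : ℕ) : ℂ)) n
  have h2 := mul_poch_add_one ((k : ℂ) - (a + b)) n
  rw [show -((k + 1 : ℕ) : ℂ) + 1 = -(k : ℂ) by push_cast; ring] at h1
  rw [show (k : ℂ) - (a + b) + 1 = ((k + 1 : ℕ) : ℂ) - (a + b) by push_cast; ring] at h2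
  rw [show ((k + 1 : ℕ) : ℂ) - 1 - (a + b) = (k : ℂ) - (a + b) by push_cast; ring]
  set u := poch (-((k + 1 : ℕ) : ℂ)) n
  set v := poch ((k : ℂ) - (a + b)) n
  set u' := poch (-(k : ℂ)) n
  set v' := poch (((k + 1 : ℕ) : ℂ) - (a + b)) n
  push_cast at h1 h2
  linear_combination racahCoeff c a b n * ((k : ℂ) + 1) * (-u) * h2 -
    racahCoeff c a b n * ((a : ℂ) + b - k) * (-v) * h1

theorem racahDual_succ_sub_aux (M k : ℕ) :
    racahDual c a b (M + 1) (k + 1) - racahDual c a b (M + 1) k =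
      ((a : ℂ) + b - 2 * k) * ∑ n ∈ Finset.range M, racahCoeff c a b (n + 1) * ((n : ℂ) + 1) ^ 2 *
        (poch (-(k : ℂ)) n * poch ((k : ℂ) - (a + b)) n) := by
  rw [racahDual, racahDual, ← Finset.sum_sub_distrib, Finset.sum_range_succ', Finset.mul_sum,
    Nat.cast_zero, zero_mul, zero_mul, zero_mul, sub_zero, add_zero]
  refine Finset.sum_congr rfl fun n _ => ?_
  rw [poch_succ' (-((k + 1 : ℕ) : ℂ)), poch_succ (-(k : ℂ)), poch_succ' ((k : ℂ) - 1 - _),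
    poch_succ (_ - 1 - _), show ((k + 1 : ℕ) : ℂ) - 1 - (a + b) = (k : ℂ) - (a + b) by
      push_cast; ring, show (k : ℂ) - 1 - (a + b) + 1 = (k : ℂ) - (a + b) by ring,
    show -((k + 1 : ℕ) : ℂ) + 1 = -(k : ℂ) by push_cast; ring]
  push_cast
  ring

theorem racahDual_succ_sub {M k : ℕ} (hk : k < M) (ha : M ≤ a) (hb : M ≤ b) :
    ((a : ℂ) - k) * (b - k) * (racahDual c a b (M + 1) (k + 1) - racahDual c a b (M + 1) k) =
      -c ^ 2 * ((a : ℂ) + b - 2 * k) * racah c a b (M + 1) k := by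
  have hB : poch (-(k : ℂ)) M = 0 := poch_neg_eq_zero hk
  -- The two sums differ by a telescoping boundary term, which vanishes at `L = M` since `(-k)_M =
  -- 0` for `k < M`.
  have key : ∀ L ≤ M, ((a : ℂ) - k) * (b - k) * ∑ n ∈ Finset.range L,
      racahCoeff c a b (n + 1) * ((n : ℂ) + 1) ^ 2 *
        (poch (-(k : ℂ)) n * poch ((k : ℂ) - (a + b)) n) =
      -c ^ 2 * (∑ n ∈ Finset.range L,
        racahCoeff c a b n * (poch (-(k : ℂ)) n * poch ((k : ℂ) - (a + b)) n)) -
      racahCoeff c a b L * (L : ℂ) ^ 2 * (poch (-(k : ℂ)) L * poch ((k : ℂ) - (a + b)) L) := by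
    intro L hL
    induction L with
    | zero => simp
    | succ L ih =>
      have ih := ih (by omega)
      have h := racahCoeff_succ (c := c) (a := a) (b := b) (n := L)
        (by exact_mod_cast (by omega : L ≠ a)) (by exact_mod_cast (by omega : L ≠ b))
      rw [Finset.sum_range_succ, Finset.sum_range_succ, poch_succ, poch_succ]
      push_cast
      linear_combination ih + (poch (-(k : ℂ)) L * poch ((k : ℂ) - (a + b)) L) * h
  have h := key M le_rfl
  rw [hB, zero_mul, mul_zero, sub_zero] at h
  rw [racahDual_succ_sub_aux, racah, Finset.sum_range_succ, hB, zero_mul, mul_zero, add_zero]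
  linear_combination ((a : ℂ) + b - 2 * k) * h

/-- At the end point `M = min a b` the numerator factors `(-M)_n (M - a - b)_n` are exactly `(-a)_n
(-b)_n` and cancel the denominators. These are nonzero because only `m < M` occurs. -/
theorem racah_self {M : ℕ} (hM : M ≤ a) (hM' : M ≤ b) (hab : M = a ∨ M = b) :
    racah c a b (M + 1) M = ∏ m ∈ Finset.range M, (1 - c ^ 2 / ((m : ℂ) + 1) ^ 2) := by
  rw [← sum_prod_div, racah]
  refine Finset.sum_congr rfl fun n hn => ?_
  have hn := Finset.mem_range.1 hn
  rw [racahCoeff, poch, poch, ← Finset.prod_mul_distrib, ← Finset.prod_mul_distrib]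
  refine Finset.prod_congr rfl fun m hm => ?_
  have hm := Finset.mem_range.1 hm
  have h1 : (m : ℂ) - a ≠ 0 := sub_ne_zero.2 (by exact_mod_cast (by omega : m ≠ a))
  have h2 : (m : ℂ) - b ≠ 0 := sub_ne_zero.2 (by exact_mod_cast (by omega : m ≠ b))
  have h3 : (m : ℂ) + 1 ≠ 0 := Nat.cast_add_one_ne_zero m
  have h4 : (-(M : ℂ) + m) * ((M : ℂ) - (a + b) + m) = (m - a) * (m - b) := by
    rcases hab with rfl | rfl <;> ring
  rw [h4]
  field_simp

/-- Two sequences linked by first order recurrences, the first of which vanishes at `min a b` when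
`c` is a nonzero integer of absolute value at most `min a b`. -/
theorem eq_zero_of_recurrence {c : ℤ} (hc : c ≠ 0) {a b : ℕ} (hca : c.natAbs ≤ a)
    (hcb : c.natAbs ≤ b) {S U : ℕ → ℂ} (hU0 : U 0 = 0)
    (hU : ∀ k, k < a → k < b → U (k + 1) = U k + c * S k * (1 / ((a : ℂ) - k) + 1 / ((b : ℂ) - k)))
    (hS : ∀ k, k < a → k < b →
      S (k + 1) = S k + c * U (k + 1) * (1 / ((a : ℂ) + b - k) - 1 / ((k : ℂ) + 1))) :
    S (min a b) = 0 := by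
  set M := min a b with hM
  have hMa : M ≤ a := min_le_left a b
  have hMb : M ≤ b := min_le_right a b
  have hc' : (c : ℂ) ≠ 0 := Int.cast_ne_zero.2 hc
  -- Both sequences are identified up to the common scalar `S 0`. The second is matched after
  -- multiplication by `c`, which turns the coefficients of the recurrences into `c²`.
  have key : ∀ k ≤ M, S k = S 0 * racah c a b (M + 1) k ∧
      c * U k = -(S 0 * racahDual c a b (M + 1) k) := by
    intro k hk
    induction k with
    | zero =>
      rw [racah_zero _ _ _ _ (Nat.succ_pos M), racahDual_zero, hU0]
      simp
    | succ k ih =>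
      obtain ⟨ih1, ih2⟩ := ih (by omega)
      have h1 : (a : ℂ) - k ≠ 0 := sub_ne_zero.2 (by exact_mod_cast (by omega : a ≠ k))
      have h2 : (b : ℂ) - k ≠ 0 := sub_ne_zero.2 (by exact_mod_cast (by omega : b ≠ k))
      have h3 : (k : ℂ) + 1 ≠ 0 := Nat.cast_add_one_ne_zero k
      have h4 : (a : ℂ) + b - k ≠ 0 := sub_ne_zero.2 (by exact_mod_cast (by omega : a + b ≠ k))
      have e1 := racahDual_succ_sub (c : ℂ) a b (show k < M by omega) hMa hMb
      have e2 := racah_succ_sub (c : ℂ) a b (M + 1) k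
      have hUk : c * U (k + 1) = -(S 0 * racahDual c a b (M + 1) (k + 1)) := by
        rw [hU k (by omega) (by omega)]
        refine mul_left_cancel₀ (mul_ne_zero h1 h2) ?_
        field_simp
        rw [ih1]
        linear_combination ((a : ℂ) - k) * (b - k) * ih2 + S 0 * e1
      refine ⟨?_, hUk⟩
      rw [hS k (by omega) (by omega)]
      refine mul_left_cancel₀ (mul_ne_zero h4 h3) ?_
      rw [hUk, ih1]
      field_simp
      linear_combination -S 0 * e2
  rw [(key M le_rfl).1, racah_self _ _ _ hMa hMb (by omega), mul_eq_zero]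
  right
  -- The factor `1 - c²/(m+1)²` vanishes at `m = |c| - 1`, which is in range as `1 ≤ |c| ≤ M`.
  refine Finset.prod_eq_zero (i := c.natAbs - 1) (Finset.mem_range.2 (by omega)) ?_
  have h1 : ((c.natAbs - 1 : ℕ) : ℂ) + 1 = (c.natAbs : ℂ) := by
    have : c.natAbs - 1 + 1 = c.natAbs := by omega
    exact_mod_cast this
  have h2 : (c.natAbs : ℂ) ^ 2 = (c : ℂ) ^ 2 := by
    rw [Nat.cast_natAbs]
    exact_mod_cast sq_abs c
  rw [h1, h2, div_self (pow_ne_zero 2 hc'), sub_self]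

end Hypergeometric

/-! ### The redundant equation, reduced to the recurrences. -/

section Vanishing

/-- The partial sum of the differences of a sequence and its reversal. -/
def revSum (g : ℕ → ℂ) (N u : ℕ) : ℂ := ∑ n ∈ Finset.range u, (g (N - n) - g n)

theorem revSum_const {g : ℕ → ℂ} {N u v : ℕ} (huv : u ≤ v)
    (h : ∀ n, u ≤ n → n < v → g n = 0 ∧ g (N - n) = 0) : revSum g N v = revSum g N u := by
  rw [revSum, revSum, ← Finset.sum_range_add_sum_Ico _ huv, add_eq_left]
  refine Finset.sum_eq_zero fun n hn => ?_
  have hn := Finset.mem_Ico.1 hn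
  rw [(h n hn.1 hn.2).1, (h n hn.1 hn.2).2, sub_zero]

theorem revSum_symm {g : ℕ → ℂ} {N u v : ℕ} (huv : u + v = N) (hu : g u = 0) (hv : g v = 0) :
    revSum g N v = revSum g N u := by
  have h := sum_range_antisymm (h := fun n => g (N - n) - g n) (N := N)
    (fun n hn => by simp only [Nat.sub_sub_self hn, neg_sub]) (u := u) (by omega)
  rw [show N + 1 - u = v + 1 by omega, Finset.sum_range_succ, show N - v = u by omega, hu, hv,
    sub_zero, add_zero] at h
  exact h

variable {r : ℕ} [NeZero r]

theorem eq_of_cast_eq {n m : ℕ} (h : (n : ZMod r) = m) (h1 : n < m + r) (h2 : m < n + r) :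
    n = m := by
  refine Nat.ModEq.eq_of_abs_lt ((ZMod.natCast_eq_natCast_iff n m r).1 h) ?_
  rw [abs_lt]
  omega

/-- Among `r` consecutive indices exactly one can carry `g n` and exactly one can carry `g (N - n)`.
-/
theorem revSum_window {g : ℕ → ℂ} {N u n₀ n₁ : ℕ} {ρ : ZMod r}
    (hg : ∀ n : ℕ, (n : ZMod r) ≠ ρ → g n = 0) (hN : u + r ≤ N + 1)
    (h0 : u ≤ n₀) (h0' : n₀ < u + r) (h0r : (n₀ : ZMod r) = ρ)
    (h1 : u ≤ n₁) (h1' : n₁ < u + r) (h1r : ((N - n₁ : ℕ) : ZMod r) = ρ) :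
    revSum g N (u + r) = revSum g N u + (g (N - n₁) - g n₀) := by
  rw [revSum, revSum, ← Finset.sum_range_add_sum_Ico _ (Nat.le_add_right u r), add_right_inj,
    Finset.sum_sub_distrib]
  congr 1
  · refine Finset.sum_eq_single_of_mem n₁ (Finset.mem_Ico.2 ⟨h1, h1'⟩) fun n hn hne => ?_
    have hn := Finset.mem_Ico.1 hn
    refine hg _ fun h => hne ?_
    have := eq_of_cast_eq (h.trans h1r.symm) (by omega) (by omega)
    omega
  · refine Finset.sum_eq_single_of_mem n₀ (Finset.mem_Ico.2 ⟨h0, h0'⟩) fun n hn hne => ?_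
    have hn := Finset.mem_Ico.1 hn
    exact hg _ fun h => hne (eq_of_cast_eq (h.trans h0r.symm) (by omega) (by omega))

/-- Two sequences supported on residue classes, coupled by their reversal sums: the equation in
which the diagonal coefficient vanishes is a consequence of the others. -/
theorem revSum_eq_zero {c : ℤ} (hc : c ≠ 0) {D E : ℕ} (hcD : c.natAbs * r ≤ D)
    (hcE : c.natAbs * r ≤ E) (hD : (D : ZMod r) ≠ 0) (hE : (E : ZMod r) ≠ 0)
    (hDE : ((D + E : ℕ) : ZMod r) ≠ 0) {g₀ g₁ : ℕ → ℂ}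
    (s₀ : ∀ n : ℕ, (n : ZMod r) ≠ 0 → g₀ n = 0) (s₁ : ∀ n : ℕ, (n : ZMod r) ≠ E → g₁ n = 0)
    (e₀ : ∀ n ≤ D + E, (n : ZMod r) = 0 → (n : ℂ) * g₀ n = c * r * revSum g₁ (D + E) n)
    (e₁ : ∀ n ≤ D + E, (n : ZMod r) = E → n ≠ E →
      ((n : ℂ) - E) * g₁ n = c * r * revSum g₀ (D + E) n) :
    revSum g₀ (D + E) E = 0 := by
  have hr0 : 0 < r := Nat.pos_of_ne_zero (NeZero.ne r)
  have hr : (r : ℂ) ≠ 0 := NeZero.ne _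
  obtain ⟨a, ε, hε, rfl⟩ : ∃ a ε, ε < r ∧ E = r * a + ε :=
    ⟨E / r, E % r, Nat.mod_lt _ hr0, (Nat.div_add_mod E r).symm⟩
  obtain ⟨b, φ, hφ, rfl⟩ : ∃ b φ, φ < r ∧ D = r * b + φ :=
    ⟨D / r, D % r, Nat.mod_lt _ hr0, (Nat.div_add_mod D r).symm⟩
  have hcast : ∀ k t : ℕ, ((r * k + t : ℕ) : ZMod r) = t := by
    intro k t
    push_cast
    rw [ZMod.natCast_self, zero_mul, zero_add]
  rw [hcast] at hD hE
  have hε0 : 0 < ε := Nat.pos_of_ne_zero fun h => hE (by rw [h, Nat.cast_zero])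
  have hφ0 : 0 < φ := Nat.pos_of_ne_zero fun h => hD (by rw [h, Nat.cast_zero])
  have hca : c.natAbs ≤ a := by
    by_contra h
    have : r * (a + 1) ≤ c.natAbs * r := by
      rw [mul_comm r]
      exact Nat.mul_le_mul_right r (by omega)
    rw [mul_add] at this
    omega
  have hcb : c.natAbs ≤ b := by
    by_contra h
    have : r * (b + 1) ≤ c.natAbs * r := by
      rw [mul_comm r]
      exact Nat.mul_le_mul_right r (by omega)
    rw [mul_add] at this
    omega
  set N := r * b + φ + (r * a + ε) with hNdef
  have hNcast : (N : ZMod r) = φ + ε := by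
    rw [hNdef, Nat.cast_add, hcast, hcast]
  have hNsub : ∀ n ≤ N, ((N - n : ℕ) : ZMod r) = φ + ε - n := by
    intro n hn
    rw [Nat.cast_sub hn, hNcast]
  rw [hNcast] at hDE
  have hsum0 : (φ : ZMod r) + ε ≠ 0 := hDE
  simp only [hcast] at s₁ e₁
  have hle : ∀ {k l : ℕ}, k < l → r * k + r ≤ r * l := by
    intro k l h
    have := Nat.mul_le_mul_left r (show k + 1 ≤ l from h)
    rwa [mul_add, mul_one] at this
  -- the first sum is constant between the two positions of a level
  have hconst₀ : ∀ k, k ≤ a → k ≤ b →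
      revSum g₀ N (r * k + φ) = revSum g₀ N (r * k + ε) := by
    intro k hka hkb
    have h1 := Nat.mul_le_mul_left r hka
    have h2 := Nat.mul_le_mul_left r hkb
    have key : ∀ n, (r * k + φ ≤ n ∨ r * k + ε ≤ n) → (n < r * k + φ ∨ n < r * k + ε) →
        g₀ n = 0 ∧ g₀ (N - n) = 0 := by
      intro n hn hn'
      constructor
      · refine s₀ n fun h => ?_
        have := eq_of_cast_eq (m := r * k + 0) (h.trans (by rw [hcast, Nat.cast_zero]))
          (by omega) (by omega)
        omega
      · refine s₀ _ fun h => ?_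
        rw [hNsub n (by omega), sub_eq_zero] at h
        have := eq_of_cast_eq (m := r * k + (φ + ε)) (h.symm.trans (by rw [hcast, Nat.cast_add]))
          (by omega) (by omega)
        omega
    rcases le_total φ ε with h | h
    · exact (revSum_const (by omega) fun n h1 h2 => key n (Or.inl h1) (Or.inr h2)).symm
    · exact revSum_const (by omega) fun n h1 h2 => key n (Or.inr h1) (Or.inl h2)
  have hconst₁ : ∀ k, k < a → k < b →
      revSum g₁ N (r * k + (φ + ε)) = revSum g₁ N (r * k + r) := by
    intro k hka hkb
    have h1 := hle hka
    have h2 := hle hkb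
    have key : ∀ n, (r * k + (φ + ε) ≤ n ∨ r * k + r ≤ n) →
        (n < r * k + (φ + ε) ∨ n < r * k + r) → g₁ n = 0 ∧ g₁ (N - n) = 0 := by
      intro n hn hn'
      constructor
      · refine s₁ n fun h => ?_
        have := eq_of_cast_eq (m := r * k + ε) (h.trans (by rw [hcast])) (by omega) (by omega)
        omega
      · refine s₁ _ fun h => ?_
        rw [hNsub n (by omega)] at h
        have h' : (n : ZMod r) = φ := by linear_combination -h
        have := eq_of_cast_eq (m := r * k + φ) (h'.trans (by rw [hcast])) (by omega) (by omega)
        omega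
    rcases le_total (φ + ε) r with h | h
    · exact (revSum_const (by omega) fun n h1 h2 => key n (Or.inl h1) (Or.inr h2)).symm
    · exact revSum_const (by omega) fun n h1 h2 => key n (Or.inr h1) (Or.inl h2)
  -- Here `a = ⌊E/r⌋` and `b = ⌊D/r⌋`. Both sums are sampled once per block of length `r`, and each
  -- step crosses two possibly nonzero terms, which the equations express by the other sum.
  have hmain := eq_zero_of_recurrence hc hca hcb (S := fun k => revSum g₀ N (r * k + ε))
    (U := fun k => revSum g₁ N (r * k)) (by simp [revSum]) (fun k hka hkb => ?_)
    (fun k hka hkb => ?_)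
  · rcases le_total a b with h | h
    · rw [min_eq_left h] at hmain
      exact hmain
    -- When `b` is the minimum, the sum known to vanish is the one up to `D`; the reversal `D ↔ E`
    -- carries it to the sum up to `E`.
    · rw [min_eq_right h] at hmain
      have h1 : revSum g₀ N (r * b + φ) = 0 := (hconst₀ b h le_rfl).trans hmain
      rw [← h1]
      refine revSum_symm hNdef.symm (s₀ _ ?_) (s₀ _ ?_)
      · rwa [hcast]
      · rwa [hcast]
  · have h1 := hle hka
    have h2 := hle hkb
    have hl : r * (a + b - k) + ε + (r * k + φ) = N := by
      have : r * (a + b - k) + r * k = r * a + r * b := by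
        rw [← mul_add, ← mul_add]
        congr 1
        omega
      omega
    have hw := revSum_window (g := g₁) (N := N) (u := r * k) (n₀ := r * k + ε) (n₁ := r * k + φ)
      s₁ (by omega) (by omega) (by omega) (hcast _ _) (by omega) (by omega)
      (by rw [hNsub _ (by omega), hcast, add_sub_cancel_left])
    rw [show N - (r * k + φ) = r * (a + b - k) + ε by omega] at hw
    have q1 := e₁ (r * k + ε) (by omega) (hcast _ _) (by omega)
    have q2 := e₁ (r * (a + b - k) + ε) (by omega) (hcast _ _) (by omega)
    -- The sum up to a far position equals the sum up to its mirror image `r k + φ`, which is again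
    -- the sample at level `k`.
    rw [← revSum_symm (u := r * (a + b - k) + ε) hl (s₀ _ (by rwa [hcast]))
      (s₀ _ (by rwa [hcast])), hconst₀ k hka.le hkb.le] at q2
    simp only [mul_add, mul_one]
    rw [hw]
    have k1 : (a : ℂ) - k ≠ 0 := sub_ne_zero.2 (by exact_mod_cast (by omega : a ≠ k))
    have k2 : (b : ℂ) - k ≠ 0 := sub_ne_zero.2 (by exact_mod_cast (by omega : b ≠ k))
    have k3 : ((a + b - k : ℕ) : ℂ) = a + b - k := by
      rw [Nat.cast_sub (by omega), Nat.cast_add]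
    push_cast [k3] at q1 q2
    have q1' : ((a : ℂ) - k) * g₁ (r * k + ε) = -(c * revSum g₀ N (r * k + ε)) :=
      mul_left_cancel₀ hr (by linear_combination -q1)
    have q2' : ((b : ℂ) - k) * g₁ (r * (a + b - k) + ε) = c * revSum g₀ N (r * k + ε) :=
      mul_left_cancel₀ hr (by linear_combination q2)
    field_simp
    linear_combination ((a : ℂ) - k) * q2' - ((b : ℂ) - k) * q1'
  · have h1 := hle hka
    have h2 := hle hkb
    have hl : r * (a + b - k) + (r * k + (φ + ε)) = N := by
      have : r * (a + b - k) + r * k = r * a + r * b := by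
        rw [← mul_add, ← mul_add]
        congr 1
        omega
      omega
    have hw := revSum_window (g := g₀) (N := N) (u := r * k + ε) (n₀ := r * k + r)
      (n₁ := r * k + (φ + ε)) s₀ (by omega) (by omega) (by omega)
      (by rw [hcast, ZMod.natCast_self]) (by omega) (by omega)
      (by rw [hNsub _ (by omega), hcast, Nat.cast_add, sub_self])
    rw [show N - (r * k + (φ + ε)) = r * (a + b - k) by omega] at hw
    have q1 := e₀ (r * k + r) (by omega) (by rw [hcast, ZMod.natCast_self])
    have hc0 : ((r * (a + b - k) : ℕ) : ZMod r) = 0 := by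
      rw [← add_zero (r * (a + b - k)), hcast, Nat.cast_zero]
    have q2 := e₀ (r * (a + b - k)) (by omega) hc0
    -- The mirror image is now `r k + (φ + ε)`, and no term of `g₁` lies between it and the sample
    -- at level `k + 1`.
    rw [← revSum_symm (u := r * (a + b - k)) hl (s₁ _ (by rw [hc0]; exact hE.symm))
      (s₁ _ (by rw [hcast, Nat.cast_add]; exact fun h => hD (by linear_combination h))),
      hconst₁ k hka hkb] at q2
    simp only [mul_add, mul_one]
    rw [show r * k + r + ε = r * k + ε + r by omega, hw]
    have k1 : (k : ℂ) + 1 ≠ 0 := Nat.cast_add_one_ne_zero k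
    have k2 : (a : ℂ) + b - k ≠ 0 := sub_ne_zero.2 (by exact_mod_cast (by omega : a + b ≠ k))
    have k3 : ((a + b - k : ℕ) : ℂ) = a + b - k := by
      rw [Nat.cast_sub (by omega), Nat.cast_add]
    push_cast [k3] at q1 q2
    have q1' : ((k : ℂ) + 1) * g₀ (r * k + r) = c * revSum g₁ N (r * k + r) :=
      mul_left_cancel₀ hr (by linear_combination q1)
    have q2' : ((a : ℂ) + b - k) * g₀ (r * (a + b - k)) = c * revSum g₁ N (r * k + r) :=
      mul_left_cancel₀ hr (by linear_combination q2)
    field_simp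
    linear_combination ((k : ℂ) + 1) * q2' - ((a : ℂ) + b - k) * q1'

end Vanishing

/-! ### The dimension of the space of singular polynomials. -/

section Dimension

variable {r : ℕ} [NeZero r] {i j k : ZMod r} {c : ℤ} {d : ZMod r → ℂ} {D E : ℕ} {f : Poly}

/-- The exponent at which the diagonal coefficient of the first Dunkl operator vanishes. -/
def gap (E : ℕ) (T : Fin 2) : ℕ := if T = 0 then 0 else E

theorem coef_opY_zero_of_gap (hE : d j - d i = E) (hf : f ∈ weightSpace ![i, j] i k)
    {a b : ℕ} {T : Fin 2} (ha : wt ![i, j] 0 (a + 1, b, T) = i) :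
    coef (a, b, T) (opY ![i, j] c d 0 f) =
      (((a + 1 : ℕ) : ℂ) - gap E T) * coef (a + 1, b, T) f -
        c * r * altSum f (a + b + 1) T.rev (a + 1) := by
  rw [wt_zero, Nat.cast_add, Nat.cast_one, ← sub_sub] at ha
  rw [coef_opY_zero _ _ hf ha]
  fin_cases T
  · simp [gap]
  · simp [gap, hE]

theorem coef_opY_one_of_gap (hD : d i - d k = D) (hE : d j - d i = E)
    (hf : f ∈ weightSpace ![i, j] i k)
    {a b : ℕ} {T : Fin 2} (hb : wt ![i, j] 1 (a, b + 1, T) = k) :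
    coef (a, b, T) (opY ![i, j] c d 1 f) =
      (((b + 1 : ℕ) : ℂ) + gap E T - (D + E)) * coef (a, b + 1, T) f +
        c * r * altSum f (a + b + 1) T.rev (b + 1) := by
  rw [wt_one, Nat.cast_add, Nat.cast_one, ← sub_sub] at hb
  rw [coef_opY_one _ _ hf hb, ← hD, ← hE]
  fin_cases T
  · simp [gap]
  · simp [gap, ← hE]
    left
    ring

/-- This supplies the vanishing middle terms that `altSum_symm` requires at every admissible
position. -/
theorem coef_rev_eq_zero (hik : i ≠ k) (hij : i ≠ j) (hf : f ∈ weightSpace ![i, j] i k)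
    {a b : ℕ} {T : Fin 2} (h0 : wt ![i, j] 0 (a, b, T) = i) (h1 : wt ![i, j] 1 (a, b, T) = k) :
    coef (a, b, T.rev) f = 0 ∧ coef (b, a, T.rev) f = 0 := by
  constructor
  · by_contra h
    have h2 := (hf _ h).1.trans h0.symm
    rw [wt_zero, wt_zero, sub_left_inj] at h2
    fin_cases T
    · exact hij h2.symm
    · exact hij h2
  · by_contra h
    have h2 := (hf _ h).1
    rw [wt_zero, ← wt_one (a := a) (T := T) ![i, j], h1] at h2
    exact hik h2.symm

/-- The partial sum at `(a, b)` involves only coefficients with smaller `min a b`, so by induction a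
nonzero coefficient must annihilate the diagonal factor of each equation present. Together with the
weights this leaves only the two given positions. -/
theorem eq_zero_of_singular (hik : i ≠ k) (hij : i ≠ j) (hjk : j ≠ k)
    (hD : d i - d k = D) (hE : d j - d i = E)
    (hf : f ∈ singular ![i, j] (c : ℂ) d i k) (h0 : coef (0, D + E, 0) f = 0)
    (h1 : coef (E, D, 1) f = 0) : f = 0 := by
  rw [mem_singular] at hf
  obtain ⟨hw, hY⟩ := hf
  suffices h : ∀ u a b T, min a b = u → coef (a, b, T) f = 0 from
    poly_ext fun a b T => by rw [h _ a b T rfl, map_zero]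
  intro u
  induction u using Nat.strong_induction_on with
  | _ u ih =>
  intro a b T hu
  by_contra hne
  obtain ⟨w0, w1⟩ := hw _ hne
  obtain ⟨r1, r2⟩ := coef_rev_eq_zero hik hij hw w0 w1
  have hsymm := altSum_symm (N := a + b) rfl r1 r2
  -- The terms of index `n < u` sit at exponents `(a + b - n, n)` and their mirrors, whose minimum
  -- is below `u`.
  have hsmall : altSum f (a + b) T.rev u = 0 := by
    refine Finset.sum_eq_zero fun n hn => ?_
    have hn := Finset.mem_range.1 hn
    rw [ih _ (show min (a + b - n) n < u by omega) _ _ _ rfl,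
      ih _ (show min n (a + b - n) < u by omega) _ _ _ rfl, sub_zero]
  have ha : altSum f (a + b) T.rev a = 0 := by
    rcases le_total a b with h | h
    · rwa [← hu, min_eq_left h] at hsmall
    · rw [← hsymm]
      rwa [← hu, min_eq_right h] at hsmall
  have hb : altSum f (a + b) T.rev b = 0 := hsymm.trans ha
  have ea : a = 0 ∨ a = gap E T := by
    rcases a with _ | a
    · exact Or.inl rfl
    · right
      have := coef_opY_zero_of_gap (c := c) hE hw w0
      rw [hY 0, map_zero, show a + b + 1 = a + 1 + b by omega, ha, mul_zero, sub_zero, zero_eq_mul,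
        or_iff_left hne, sub_eq_zero] at this
      exact_mod_cast this
  have eb : b = 0 ∨ b + gap E T = D + E := by
    rcases b with _ | b
    · exact Or.inl rfl
    · right
      have := coef_opY_one_of_gap (c := c) hD hE hw w1
      rw [hY 1, map_zero, show a + b + 1 = a + (b + 1) by omega, hb, mul_zero, add_zero,
        zero_eq_mul, or_iff_left hne, sub_eq_zero] at this
      exact_mod_cast this
  have hT : T = 0 ∨ T = 1 := by fin_cases T <;> simp
  rcases hT with rfl | rfl
  · have ea : a = 0 := ea.elim id id
    subst ea
    rcases eb with rfl | eb
    · rw [wt_one, Nat.cast_zero, sub_zero] at w1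
      exact hjk w1
    · have eb : b = D + E := eb
      rw [eb] at hne
      exact hne h0
  · have ea : a = E := ea.resolve_left fun h => by
      rw [h, wt_zero, Nat.cast_zero, sub_zero] at w0
      exact hij w0.symm
    have eb : b = D := by
      rcases eb with rfl | eb
      · rw [wt_one, Nat.cast_zero, sub_zero] at w1
        exact absurd w1 hik
      · change b + E = D + E at eb
        omega
    rw [ea, eb] at hne
    exact hne h1

theorem mem_singular_of_equations (hik : i ≠ k) (hij : i ≠ j)
    (hD : d i - d k = D) (hE : d j - d i = E) (hw : f ∈ weightSpace ![i, j] i k)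
    (hN : ∀ a b T, coef (a, b, T) f ≠ 0 → a + b = D + E)
    (heq : ∀ a b T, a + b = D + E → wt ![i, j] 0 (a, b, T) = i → wt ![i, j] 1 (a, b, T) = k →
      ((a : ℂ) - gap E T) * coef (a, b, T) f = c * r * altSum f (D + E) T.rev a) :
    f ∈ singular ![i, j] (c : ℂ) d i k := by
  have hsum : ∀ N T u, u ≤ N + 1 → N ≠ D + E → altSum f N T u = 0 := by
    intro N T u hu hne
    refine Finset.sum_eq_zero fun n hn => ?_
    have hn := Finset.mem_range.1 hn
    have h1 : coef (N - n, n, T) f = 0 := by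
      by_contra h
      have := hN _ _ _ h
      omega
    have h2 : coef (n, N - n, T) f = 0 := by
      by_contra h
      have := hN _ _ _ h
      omega
    rw [h1, h2, sub_zero]
  rw [mem_singular]
  refine ⟨hw, fun p => ?_⟩
  have hp : p = 0 ∨ p = 1 := by fin_cases p <;> simp
  refine poly_ext fun a b T => ?_
  rw [map_zero]
  by_contra hne
  rcases hp with rfl | rfl
  · obtain ⟨w0, w1⟩ := opY_zero_mem (c : ℂ) d hw _ hne
    have w0' : wt ![i, j] 0 (a + 1, b, T) = i := by
      rw [wt_zero] at w0 ⊢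
      push_cast
      linear_combination w0
    refine hne ?_
    rw [coef_opY_zero_of_gap hE hw w0']
    by_cases h : a + b + 1 = D + E
    · rw [heq (a + 1) b T (by omega) w0' w1, h, sub_self]
    · have : coef (a + 1, b, T) f = 0 := by
        by_contra h'
        have := hN _ _ _ h'
        omega
      rw [this, hsum _ _ _ (by omega) h, mul_zero, mul_zero, sub_zero]
  · obtain ⟨w0, w1⟩ := opY_one_mem (c : ℂ) d hw _ hne
    have w1' : wt ![i, j] 1 (a, b + 1, T) = k := by
      rw [wt_one] at w1 ⊢
      push_cast
      linear_combination w1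
    refine hne ?_
    rw [coef_opY_one_of_gap hD hE hw w1']
    by_cases h : a + b + 1 = D + E
    -- In degree `D + E` the diagonal factor of `y₂` is minus that of `y₁`, and the partial sums
    -- agree by symmetry.
    · obtain ⟨r1, r2⟩ := coef_rev_eq_zero hik hij hw (a := a) (b := b + 1) (T := T) w0 w1'
      have hs := altSum_symm (N := D + E) (by omega) r1 r2
      have := heq a (b + 1) T (by omega) w0 w1'
      have hc : (a : ℂ) + b + 1 = D + E := by exact_mod_cast h
      rw [h, hs, ← this]
      push_cast
      linear_combination coef (a, b + 1, T) f * hc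
    · have : coef (a, b + 1, T) f = 0 := by
        by_contra h'
        have := hN _ _ _ h'
        omega
      rw [this, hsum _ _ _ (by omega) h, mul_zero, mul_zero, add_zero]

theorem altSum_eq_revSum (f : Poly) {N u : ℕ} (T : Fin 2) (hu : u ≤ N) :
    altSum f N T u = revSum (fun n => coef (n, N - n, T) f) N u := by
  refine Finset.sum_congr rfl fun n hn => ?_
  have hn := Finset.mem_range.1 hn
  simp only [Nat.sub_sub_self (show n ≤ N by omega)]

theorem altSum_eq_zero (hc : c ≠ 0) (hik : i ≠ k) (hij : i ≠ j) (hjk : j ≠ k)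
    (hDz : (D : ZMod r) = i - k) (hEz : (E : ZMod r) = j - i)
    (hcD : c.natAbs * r ≤ D) (hcE : c.natAbs * r ≤ E) (hw : f ∈ weightSpace ![i, j] i k)
    (heq : ∀ a b T, a + b = D + E → wt ![i, j] 0 (a, b, T) = i → wt ![i, j] 1 (a, b, T) = k →
      (a, T) ≠ (E, (1 : Fin 2)) →
      ((a : ℂ) - gap E T) * coef (a, b, T) f = c * r * altSum f (D + E) T.rev a) :
    altSum f (D + E) 0 E = 0 := by
  rw [altSum_eq_revSum f 0 (by omega)]
  have hcast : ∀ n ≤ D + E, ((D + E - n : ℕ) : ZMod r) = j - k - n := by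
    intro n hn
    rw [Nat.cast_sub hn, Nat.cast_add, hDz, hEz]
    ring
  refine revSum_eq_zero hc (g₁ := fun n => coef (n, D + E - n, 1) f) hcD hcE
    (by rw [hDz]; exact sub_ne_zero.2 hik) (by rw [hEz]; exact sub_ne_zero.2 hij.symm)
    (by rw [Nat.cast_add, hDz, hEz, sub_add_sub_cancel']; exact sub_ne_zero.2 hjk)
    (fun n hn => ?_) (fun n hn => ?_) (fun n hn h => ?_) fun n hn h hne => ?_
  · by_contra h
    have := (hw _ h).1
    rw [wt_zero] at this
    exact hn (sub_eq_self.1 this)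
  · by_contra h
    have := (hw _ h).1
    rw [wt_zero] at this
    change j - n = i at this
    refine hn ?_
    rw [hEz]
    linear_combination -this
  · have := heq n (D + E - n) 0 (by omega) (by rw [wt_zero, h, sub_zero]; rfl) (by
      rw [wt_one, hcast n hn, h]
      change j - _ = k
      ring) (by simp)
    rw [altSum_eq_revSum f _ hn] at this
    simpa [gap] using this
  · have := heq n (D + E - n) 1 (by omega) (by
      rw [wt_zero, h, hEz]
      change j - _ = i
      ring) (by
      rw [wt_one, hcast n hn, h, hEz]
      change i - _ = k
      ring) (by simp [hne])
    rw [altSum_eq_revSum f _ hn] at this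
    simpa [gap] using this

/-- The exponents and indices in a given degree and weight. -/
def slots (i j k : ZMod r) (N : ℕ) : Finset (ℕ × Fin 2) :=
  (Finset.range (N + 1) ×ˢ Finset.univ).filter fun s =>
    wt ![i, j] 0 (s.1, N - s.1, s.2) = i ∧ wt ![i, j] 1 (s.1, N - s.1, s.2) = k

theorem mem_slots {N a : ℕ} {T : Fin 2} : (a, T) ∈ slots i j k N ↔
    a ≤ N ∧ wt ![i, j] 0 (a, N - a, T) = i ∧ wt ![i, j] 1 (a, N - a, T) = k := by
  simp [slots]

/-- The polynomial with given coefficients. -/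
def ofCoeffs (i j k : ZMod r) (N : ℕ) : (slots i j k N → ℂ) →ₗ[ℂ] Poly :=
  Fintype.linearCombination ℂ fun s => monom (s.1.1, N - s.1.1, s.1.2)

theorem coef_ofCoeffs {N : ℕ} (x : slots i j k N → ℂ) (s : slots i j k N) :
    coef (s.1.1, N - s.1.1, s.1.2) (ofCoeffs i j k N x) = x s := by
  rw [ofCoeffs, Fintype.linearCombination_apply, map_sum,
    Finset.sum_eq_single_of_mem s (Finset.mem_univ s)]
  · rw [map_smul, coef_monom, if_pos rfl, smul_eq_mul, mul_one]
  · intro t _ hts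
    rw [map_smul, coef_monom, if_neg, smul_zero]
    intro h
    simp only [Prod.mk.injEq] at h
    exact hts (Subtype.ext (Prod.ext h.1 h.2.2))

theorem of_coef_ofCoeffs_ne_zero {N a b : ℕ} {T : Fin 2} {x : slots i j k N → ℂ}
    (h : coef (a, b, T) (ofCoeffs i j k N x) ≠ 0) : a + b = N ∧ (a, T) ∈ slots i j k N := by
  rw [ofCoeffs, Fintype.linearCombination_apply, map_sum] at h
  obtain ⟨s, -, hs⟩ := Finset.exists_ne_zero_of_sum_ne_zero h
  rw [map_smul, coef_monom] at hs
  have hs : (s.1.1, N - s.1.1, s.1.2) = (a, b, T) := by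
    by_contra h'
    rw [if_neg h', smul_zero] at hs
    exact hs rfl
  simp only [Prod.mk.injEq] at hs
  obtain ⟨rfl, rfl, rfl⟩ := hs
  exact ⟨Nat.add_sub_of_le (mem_slots.1 s.2).1, s.2⟩

theorem ofCoeffs_mem {N : ℕ} (x : slots i j k N → ℂ) :
    ofCoeffs i j k N x ∈ weightSpace ![i, j] i k := by
  rintro ⟨a, b, T⟩ h
  obtain ⟨rfl, h⟩ := of_coef_ofCoeffs_ne_zero h
  have := (mem_slots.1 h).2
  rwa [Nat.add_sub_cancel_left] at this

theorem ofCoeffs_injective {N : ℕ} : Function.Injective (ofCoeffs i j k N) := by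
  intro x y h
  funext s
  rw [← coef_ofCoeffs x s, h, coef_ofCoeffs]

theorem finrank_singular (hc : c ≠ 0) (hik : i ≠ k) (hij : i ≠ j) (hjk : j ≠ k)
    (hD : d i - d k = D) (hDz : (D : ZMod r) = i - k) (hE : d j - d i = E)
    (hEz : (E : ZMod r) = j - i) (hcD : c.natAbs * r ≤ D) (hcE : c.natAbs * r ≤ E) :
    Module.finrank ℂ (singular ![i, j] (c : ℂ) d i k) = 2 := by
  -- Evaluation at the two exceptional coefficients gives the upper bound.
  let ev : singular ![i, j] (c : ℂ) d i k →ₗ[ℂ] ℂ × ℂ :=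
    ((coef (0, D + E, 0)).prod (coef (E, D, 1))).comp (Submodule.subtype _)
  have hev : Function.Injective ev := by
    rw [← LinearMap.ker_eq_bot, LinearMap.ker_eq_bot']
    intro f hf
    have hf := Prod.ext_iff.1 hf
    exact Subtype.ext (eq_zero_of_singular hik hij hjk hD hE f.2 hf.1 hf.2)
  have : FiniteDimensional ℂ (singular ![i, j] (c : ℂ) d i k) := FiniteDimensional.of_injective ev hev
  refine le_antisymm ?_ ?_
  · have := LinearMap.finrank_le_finrank_of_injective hev
    rwa [Module.finrank_prod, Module.finrank_self] at this
  set I := slots i j k (D + E)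
  -- The equations at the two exceptional positions are omitted: the first is void, the second will
  -- follow from the others.
  set J := (I.erase (0, 0)).erase (E, 1)
  have hp : ((0, 0) : ℕ × Fin 2) ∈ I := by
    refine mem_slots.2 ⟨Nat.zero_le _, ?_, ?_⟩
    · rw [wt_zero, Nat.cast_zero, sub_zero]
      rfl
    · rw [wt_one, Nat.sub_zero, Nat.cast_add, hDz, hEz]
      change j - _ = k
      ring
  have hq : ((E, 1) : ℕ × Fin 2) ∈ I.erase (0, 0) := by
    refine Finset.mem_erase.2 ⟨by simp, mem_slots.2 ⟨by omega, ?_, ?_⟩⟩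
    · rw [wt_zero, hEz]
      change j - _ = i
      ring
    · rw [wt_one, Nat.add_sub_cancel, hDz]
      change i - _ = k
      ring
  have hcard : J.card + 2 = I.card := by
    have h1 : J.card + 1 = (I.erase (0, 0)).card := Finset.card_erase_add_one hq
    have h2 : (I.erase (0, 0)).card + 1 = I.card := Finset.card_erase_add_one hp
    omega
  -- The `y₁`-equation at exponent `a` is read off from the coefficient at `a - 1`; in `J` every `a`
  -- is positive, since exponent `0` occurs only in the removed slot.
  let Φ : (I → ℂ) →ₗ[ℂ] (J → ℂ) := LinearMap.pi fun s =>
    coef (s.1.1 - 1, D + E - s.1.1, s.1.2) ∘ₗ opY ![i, j] (c : ℂ) d 0 ∘ₗ ofCoeffs i j k (D + E)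
  have hΦ : 2 ≤ Module.finrank ℂ (LinearMap.ker Φ) := by
    have h1 := LinearMap.finrank_range_add_finrank_ker Φ
    have h2 := Submodule.finrank_le (LinearMap.range Φ)
    rw [Module.finrank_fintype_fun_eq_card, Fintype.card_coe] at h1 h2
    omega
  have hmem : ∀ x ∈ LinearMap.ker Φ, ofCoeffs i j k (D + E) x ∈ singular ![i, j] (c : ℂ) d i k := by
    intro x hx
    have hw := ofCoeffs_mem x
    have heq : ∀ a b T, a + b = D + E → wt ![i, j] 0 (a, b, T) = i → wt ![i, j] 1 (a, b, T) = k →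
        (a, T) ≠ (E, (1 : Fin 2)) →
        ((a : ℂ) - gap E T) * coef (a, b, T) (ofCoeffs i j k (D + E) x) =
          c * r * altSum (ofCoeffs i j k (D + E) x) (D + E) T.rev a := by
      intro a b T hab w0 w1 hne
      have hb : D + E - a = b := by omega
      rcases a with _ | a
      -- At `a = 0` the weight forces the first index, and both sides of the equation are zero.
      · have hT : T = 0 := by
          by_contra hT
          have hT : T = 1 := Fin.eq_one_of_ne_zero T hT
          rw [hT, wt_zero, Nat.cast_zero, sub_zero] at w0
          exact hij w0.symm
        simp [hT, gap, altSum]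
      · have hJ : (a + 1, T) ∈ J := by
          refine Finset.mem_erase.2 ⟨hne, Finset.mem_erase.2 ⟨by simp, mem_slots.2
            ⟨by omega, ?_, ?_⟩⟩⟩
          · rwa [hb]
          · rwa [hb]
        have h := congrFun (LinearMap.mem_ker.1 hx) ⟨(a + 1, T), hJ⟩
        change coef (a + 1 - 1, D + E - (a + 1), T) (opY ![i, j] (c : ℂ) d 0 _) = 0 at h
        rw [hb, Nat.add_sub_cancel, coef_opY_zero_of_gap hE hw w0,
          show a + b + 1 = D + E by omega, sub_eq_zero] at h
        exact h
    have h0 := altSum_eq_zero hc hik hij hjk hDz hEz hcD hcE hw heq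
    refine mem_singular_of_equations hik hij hD hE hw
      (fun a b T h => (of_coef_ofCoeffs_ne_zero h).1) fun a b T hab w0 w1 => ?_
    by_cases h : (a, T) = (E, 1)
    · rw [Prod.mk.injEq] at h
      obtain ⟨rfl, rfl⟩ := h
      change _ = c * r * altSum _ _ 0 a
      rw [h0]
      simp [gap]
    · exact heq a b T hab w0 w1 h
  let θ : LinearMap.ker Φ →ₗ[ℂ] singular ![i, j] (c : ℂ) d i k :=
    ((ofCoeffs i j k (D + E)).comp (Submodule.subtype _)).codRestrict _ fun x => hmem x.1 x.2
  have hθ : Function.Injective θ := fun x y h =>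
    Subtype.ext (ofCoeffs_injective (congrArg Subtype.val h))
  exact hΦ.trans (LinearMap.finrank_le_finrank_of_injective hθ)

/-- Nonnegativity of `x + c r` and of `x - c r` together amounts to `x ≥ |c| r`, and `c r` does not
change the residue modulo `r`. -/
theorem exists_nat_gap {x : ℂ} {c : ℤ} {m : ZMod r}
    (h₁ : ∃ n : ℕ, x + c * r = n ∧ (n : ZMod r) = m) (h₂ : ∃ n : ℕ, x - c * r = n ∧ (n : ZMod r) = m) :
    ∃ D : ℕ, x = D ∧ (D : ZMod r) = m ∧ c.natAbs * r ≤ D := by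
  obtain ⟨n₁, h₁, h₁'⟩ := h₁
  obtain ⟨n₂, h₂, -⟩ := h₂
  have hx : x = ((n₁ - c * r : ℤ) : ℂ) := by
    push_cast
    linear_combination h₁
  have hz : (n₁ : ℤ) - c * r = n₂ + c * r := by
    have : ((n₁ - c * r : ℤ) : ℂ) = ((n₂ + c * r : ℤ) : ℂ) := by
      rw [← hx]
      push_cast
      linear_combination h₂
    exact_mod_cast this
  have hle : (c.natAbs : ℤ) * r ≤ n₁ - c * r := by
    rcases Int.natAbs_eq c with h | h
    · rw [← h, hz]
      omega
    · have : (c.natAbs : ℤ) = -c := by omega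
      rw [this, neg_mul]
      omega
  have hD : 0 ≤ (n₁ : ℤ) - c * r := le_trans (by positivity) hle
  obtain ⟨D, hD⟩ := Int.eq_ofNat_of_zero_le hD
  refine ⟨D, ?_, ?_, ?_⟩
  · rw [hx, hD, Int.cast_natCast]
  · have := congrArg (Int.cast : ℤ → ZMod r) hD
    push_cast at this
    rw [← this, h₁', ZMod.natCast_self, mul_zero, sub_zero]
  · rw [hD] at hle
    exact_mod_cast hle

end Dimension

end RCA

end

theorem mainTheorem2 (r : ℕ) [NeZero r] (ζ : rootsOfUnity r ℂ) (hζ : IsPrimitiveRoot ζ r)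
    (c₀ : ℂ) (hc₀ : ∃ c : ℤ, c ≠ 0 ∧ c₀ = c)
    (d : ZMod r → ℂ) (hd : ∑ l, d l = 0)
    (i j k : ZMod r) (hik : i ≠ k) (hij : i ≠ j)
    (h₁ : ∃ n : ℕ, d i - d k + c₀ * r = n ∧ (n : ZMod r) = i - k)
    (h₂ : ∃ n : ℕ, d i - d k - c₀ * r = n ∧ (n : ZMod r) = i - k)
    (h₃ : ∃ n : ℕ, d j - d i + c₀ * r = n ∧ (n : ZMod r) = j - i)
    (h₄ : ∃ n : ℕ, d j - d i - c₀ * r = n ∧ (n : ZMod r) = j - i) :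
    Module.finrank ℂ
      (RCA.StandardPair ζ c₀ d i k →ₗ[RCA.H ζ c₀ d] RCA.StandardPair ζ c₀ d i j) = 2 := by
  obtain ⟨c, hc, rfl⟩ := hc₀
  obtain ⟨D, hD, hDz, hcD⟩ := RCA.exists_nat_gap h₁ h₂
  obtain ⟨E, hE, hEz, hcE⟩ := RCA.exists_nat_gap h₃ h₄
  -- If `j = k`, then `D + E = 0`, so `D = 0` and its congruence forces `i = k`.
  have hjk : j ≠ k := by
    rintro rfl
    have h : (D : ℂ) + E = 0 := by
      rw [← hD, ← hE]
      ring
    have h : D + E = 0 := by exact_mod_cast h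
    have hD0 : D = 0 := by omega
    rw [hD0, Nat.cast_zero] at hDz
    exact hik (sub_eq_zero.1 hDz.symm)
  rw [RCA.finrank_hom (c : ℂ) d hζ i j k]
  exact RCA.finrank_singular hc hik hij hjk hD hDz hE hEz hcD hcE
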